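/- Let $V$ be a complex vector space of dimension $4$ with a nondegenerate $2$-form $\beta\in\Lambda^2(V^*)$, let $\Omega=\tfrac12\beta\wedge\beta$, let $W\subset\Lambda^2(V)$ be the $5$-dimensional subspace annihilated by $\beta$, with the nondegenerate symmetric inner product $\langle w_1,w_2\rangle=\Omega(w_1\wedge w_2)$, and let $\mathbb{Q}^3=\{[w]\in\mathbb{P}(W) : \langle w,w\rangle=0\}$ be its null hyperquadric in $\mathbb{P}(W)\simeq\mathbb{P}^4$. A *null curve* $g:\mathbb{P}^1\to\mathbb{Q}^3$ is a nonconstant holomorphic map such that, for every local holomorphic nonvanishing lift $G$ (so $g=[G]$), $\langle G,G\rangle=\langle G,dG\rangle=\langle dG,dG\rangle=0$. It is *nonlinear* if its image does not lie in a line of $\mathbb{P}(W)$. Its *degree* is the number of points of $g^{-1}(H)$ for any hyperplane $H$ that is nowhere tangent to $g$. If, near $p$, $g=[h_0v_0+\dots+h_4v_4]$ for a basis $v_0,\dots,v_4$ of $W$ and holomorphic $h_i$ vanishing at $p$ to orders $0=a_0<a_1<\dots<a_4$, then $p$ is a *branch point of order* $a_1-a_0-1$ when this number is positive, and $g$ is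 *unbranched* if it has no branch points. A *contact curve* $f=[F]:\mathbb{P}^1\to\mathbb{P}(V)$ is a holomorphic map with $\beta(F,dF)=0$ for its local lifts $F$; its associated curve is $f_2=[F\wedge F']:\mathbb{P}^1\to\mathbb{P}(W)$ (extended holomorphically over the zeros of $F\wedge F'$). Two null curves $g,g'$ are *projectively equivalent* if $g'\circ\varphi=T\circ g$ for a projective automorphism $\varphi$ of $\mathbb{P}^1$ and a projective transformation $T$ of $\mathbb{P}(W)$ that maps $\mathbb{Q}^3$ to itself. **Proposition.** Up to projective equivalence there are exactly two nonlinear null curves $g:\mathbb{P}^1\to\mathbb{Q}^3$ of degree $6$. More precisely, there are two nonlinear null curves $g_1,g_2:\mathbb{P}^1\to\mathbb{Q}^3$ of degree $6$ such that 1. $g_1$ is unbranched, and $g_1=f_2$ for a contact curve $f:\mathbb{P}^1\to\mathbb{P}(V)$ that in some basis of $V$ and an affine coordinate $z$ on $\mathbb{P}^1$ has the form $f=[1,z^2,z^3,z^5]$; 2. $g_2$ has exactly two branch points, each of order $1$, and $g_2=f_2$ for a contact curve $f:\mathbb{P}^1\to\mathbb{P}(V)$ that in some basis of $V$ and an affine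 coordinate $z$ on $\mathbb{P}^1$ has the form $f=[1,z,z^3,z^4]$; 3. $g_1$ and $g_2$ are not projectively equivalent; 4. every nonlinear null curve $g:\mathbb{P}^1\to\mathbb{Q}^3$ of degree $6$ is projectively equivalent to $g_1$ or to $g_2$. -/

import Mathlib

open scoped LinearAlgebra.Projectivization Topology

noncomputable section

namespace NullCurve

/-- The complex projective line. -/
abbrev P1 : Type := ℙ ℂ (Fin 2 → ℂ)

/-- The two standard affine coordinates on the projective line:
`z ↦ [1, z]` (for `j = 0`) and `z ↦ [z, 1]` (for `j = 1`). -/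
def chart (j : Fin 2) (z : ℂ) : P1 :=
  Projectivization.mk ℂ (if j = 0 then ![1, z] else ![z, 1]) (by
    intro h
    split_ifs at h
    · simpa using congrFun h 0
    · simpa using congrFun h 1)

section Curves

variable {E : Type*} [AddCommGroup E] [Module ℂ E]

/-- The point `p` of projective space is the class `[v]` of the nonzero vector `v`. -/
def IsClassOf (p : ℙ ℂ E) (v : E) : Prop :=
  ∃ hv : v ≠ 0, p = Projectivization.mk ℂ v hv

/-- The vector valued function `F` has derivative `F'` at `z`. The space `E` is finite-dimensional
whenever this is used, so that it suffices to test with linear functionals. -/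
def HasVecDerivAt (F : ℂ → E) (F' : E) (z : ℂ) : Prop :=
  ∀ l : Module.Dual ℂ E, HasDerivAt (fun w => l (F w)) (l F') z

/-- `F` is holomorphic near `z₀`, and `f = [F]` (with `F` nonvanishing) near the point with
coordinate `z₀` in the `j`-th affine coordinate. -/
def IsLocalLift (f : P1 → ℙ ℂ E) (j : Fin 2) (z₀ : ℂ) (F : ℂ → E) : Prop :=
  (∀ l : Module.Dual ℂ E, AnalyticAt ℂ (fun z => l (F z)) z₀) ∧
    ∀ᶠ z in 𝓝 z₀, IsClassOf (f (chart j z)) (F z)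

/-- A holomorphic curve `ℙ¹ → ℙ(E)`. -/
def IsHolomorphic (f : P1 → ℙ ℂ E) : Prop :=
  ∀ (j : Fin 2) (z₀ : ℂ), ∃ F : ℂ → E, IsLocalLift f j z₀ F

/-- The image of `f` does not lie in a projective line. -/
def IsNonlinear (f : P1 → ℙ ℂ E) : Prop :=
  ¬ ∃ L : Submodule ℂ E, Module.finrank ℂ L = 2 ∧ ∀ p, (f p).submodule ≤ L

/-- The hyperplane `ker l` is nowhere tangent to `f`: wherever the curve meets it, it does so
transversally. -/
def NowhereTangent (f : P1 → ℙ ℂ E) (l : Module.Dual ℂ E) : Prop :=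
  ∀ (j : Fin 2) (z₀ : ℂ) (F : ℂ → E) (F' : E),
    IsLocalLift f j z₀ F → HasVecDerivAt F F' z₀ → l (F z₀) = 0 → l F' ≠ 0

/-- `f` has degree `d`: there are hyperplanes that are nowhere tangent to `f`, and the preimage of
each of them consists of exactly `d` points. -/
def HasDegree (f : P1 → ℙ ℂ E) (d : ℕ) : Prop :=
  (∃ l : Module.Dual ℂ E, l ≠ 0 ∧ NowhereTangent f l) ∧
    ∀ l : Module.Dual ℂ E, l ≠ 0 → NowhereTangent f l →
      {p : P1 | (f p).submodule ≤ LinearMap.ker l}.encard = d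

/-- The vanishing orders `0 = a₀ < a₁ < ⋯ < aₙ` of `f` at `p`: near `p` one can write
`f = [h₀ v₀ + ⋯ + hₙ vₙ]` with `v₀, …, vₙ` a basis of `E` and `hᵢ` holomorphic, vanishing to order
exactly `aᵢ` at `p`. -/
def HasVanishingOrders {n : ℕ} (f : P1 → ℙ ℂ E) (p : P1) (a : Fin (n + 1) → ℕ) : Prop :=
  a 0 = 0 ∧ StrictMono a ∧
    ∃ (j : Fin 2) (z₀ : ℂ), chart j z₀ = p ∧
      ∃ (v : Module.Basis (Fin (n + 1)) ℂ E) (h : Fin (n + 1) → ℂ → ℂ),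
        (∀ i, AnalyticAt ℂ (h i) z₀ ∧ analyticOrderAt (h i) z₀ = (a i : ℕ∞)) ∧
          ∀ᶠ z in 𝓝 z₀, IsClassOf (f (chart j z)) (∑ i, h i z • v i)

/-- The first ramification degree `r₁(p) = a₁(p) - a₀(p) - 1` of `f` at `p` equals `r`. For `r > 0`
this says that `p` is a branch point of order `r`. -/
def HasBranchOrder (f : P1 → ℙ ℂ E) (p : P1) (r : ℕ) : Prop :=
  ∃ (n : ℕ) (a : Fin (n + 2) → ℕ), HasVanishingOrders f p a ∧ a 1 = a 0 + 1 + r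

/-- `f` has no branch points. -/
def IsUnbranched (f : P1 → ℙ ℂ E) : Prop :=
  ∀ p, HasBranchOrder f p 0

/-- `f` has exactly two branch points, each of order `1`. -/
def HasTwoSimpleBranchPoints (f : P1 → ℙ ℂ E) : Prop :=
  ∃ p q : P1, p ≠ q ∧ HasBranchOrder f p 1 ∧ HasBranchOrder f q 1 ∧
    ∀ x, x ≠ p → x ≠ q → HasBranchOrder f x 0

/-- The hyperquadric of null lines of the symmetric bilinear form `B`. -/
def nullQuadric (B : LinearMap.BilinForm ℂ E) : Set (ℙ ℂ E) :=
  {p | ∀ w ∈ p.submodule, B w w = 0}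

/-- A null curve in the null hyperquadric of `B`: a nonconstant holomorphic curve `g = [G]` with
values in the quadric and with `⟨G, G⟩ = ⟨G, dG⟩ = ⟨dG, dG⟩ = 0`, i.e. whose tangent lines lie in
the quadric. -/
structure IsNullCurve (B : LinearMap.BilinForm ℂ E) (g : P1 → ℙ ℂ E) : Prop where
  holomorphic : IsHolomorphic g
  nonconstant : ∃ p q, g p ≠ g q
  mem_quadric : ∀ p, g p ∈ nullQuadric B
  null : ∀ (j : Fin 2) (z₀ : ℂ) (G : ℂ → E) (G' : E),
    IsLocalLift g j z₀ G → HasVecDerivAt G G' z₀ →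
      B (G z₀) (G z₀) = 0 ∧ B (G z₀) G' = 0 ∧ B G' G' = 0

/-- Projective equivalence of curves in the null hyperquadric of `B`: up to a projective
change of parameter on `ℙ¹` they differ by a projective transformation of `ℙ(E)` that maps
the quadric to itself. -/
def ProjEquiv (B : LinearMap.BilinForm ℂ E) (g g' : P1 → ℙ ℂ E) : Prop :=
  ∃ (A : (Fin 2 → ℂ) ≃ₗ[ℂ] (Fin 2 → ℂ)) (T : E ≃ₗ[ℂ] E),
    (∀ w, B (T w) (T w) = 0 ↔ B w w = 0) ∧
      ∀ p, g' (Projectivization.map A.toLinearMap A.injective p) =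
        Projectivization.map T.toLinearMap T.injective (g p)

end Curves

section Klein

theorem fin_four (i : Fin 4) : i = 0 ∨ i = 1 ∨ i = 2 ∨ i = 3 := by
  revert i; decide

theorem update_pair_0 {X : Type*} (x y z : X) : Function.update ![x, y] 0 z = ![z, y] := by
  ext i; fin_cases i <;> simp

theorem update_pair_1 {X : Type*} (x y z : X) : Function.update ![x, y] 1 z = ![x, z] := by
  ext i; fin_cases i <;> simp

variable {V : Type*} [AddCommGroup V] [Module ℂ V]

/-- The `2`-form `β` is nondegenerate. -/
def IsNondegenerate (β : V [⋀^Fin 2]→ₗ[ℂ] ℂ) : Prop :=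
  ∀ v, (∀ w, β ![v, w] = 0) → v = 0

/-- The subspace `W` of `Λ²V` annihilated by `β`. -/
abbrev W (β : V [⋀^Fin 2]→ₗ[ℂ] ℂ) : Submodule ℂ (⋀[ℂ]^2 V) :=
  LinearMap.ker (exteriorPower.alternatingMapLinearEquiv β)

theorem form_add_left (β : V [⋀^Fin 2]→ₗ[ℂ] ℂ) (x y z : V) :
    β ![x + y, z] = β ![x, z] + β ![y, z] := by
  have h := β.map_update_add ![x, z] 0 x y
  simpa [-AlternatingMap.map_update_add, update_pair_0] using h

theorem form_add_right (β : V [⋀^Fin 2]→ₗ[ℂ] ℂ) (x y z : V) :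
    β ![z, x + y] = β ![z, x] + β ![z, y] := by
  have h := β.map_update_add ![z, x] 1 x y
  simpa [-AlternatingMap.map_update_add, update_pair_1] using h

theorem form_smul_left (β : V [⋀^Fin 2]→ₗ[ℂ] ℂ) (c : ℂ) (x z : V) :
    β ![c • x, z] = c * β ![x, z] := by
  have h := β.map_update_smul ![x, z] 0 c x
  simpa [-AlternatingMap.map_update_smul, update_pair_0] using h

theorem form_smul_right (β : V [⋀^Fin 2]→ₗ[ℂ] ℂ) (c : ℂ) (x z : V) :
    β ![z, c • x] = c * β ![z, x] := by
  have h := β.map_update_smul ![z, x] 1 c x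
  simpa [-AlternatingMap.map_update_smul, update_pair_1] using h

theorem form_self (β : V [⋀^Fin 2]→ₗ[ℂ] ℂ) (x : V) : β ![x, x] = 0 :=
  β.map_eq_zero_of_eq ![x, x] (i := 0) (j := 1) rfl (by decide)

theorem form_swap (β : V [⋀^Fin 2]→ₗ[ℂ] ℂ) (x y : V) : β ![x, y] = -β ![y, x] := by
  have h := form_self β (x + y)
  rw [form_add_left, form_add_right, form_add_right, form_self, form_self] at h
  linear_combination h

/-- The volume form `Ω = ½ β ∧ β`. -/
def volumeForm (β : V [⋀^Fin 2]→ₗ[ℂ] ℂ) : V [⋀^Fin 4]→ₗ[ℂ] ℂ where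
  toFun v := β ![v 0, v 1] * β ![v 2, v 3] - β ![v 0, v 2] * β ![v 1, v 3]
    + β ![v 0, v 3] * β ![v 1, v 2]
  map_update_add' {inst} v i x y := by
    obtain rfl : inst = instDecidableEqFin 4 := Subsingleton.elim _ _
    rcases fin_four i with rfl | rfl | rfl | rfl <;> simp [Function.update, form_add_left, form_add_right] <;> ring
  map_update_smul' {inst} v i c x := by
    obtain rfl : inst = instDecidableEqFin 4 := Subsingleton.elim _ _
    rcases fin_four i with rfl | rfl | rfl | rfl <;> simp [Function.update, form_smul_left, form_smul_right] <;> ring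
  map_eq_zero_of_eq' v i j h hij := by
    have h01 := form_swap β (v 0) (v 1)
    have h02 := form_swap β (v 0) (v 2)
    have h03 := form_swap β (v 0) (v 3)
    have h12 := form_swap β (v 1) (v 2)
    have h13 := form_swap β (v 1) (v 3)
    have h23 := form_swap β (v 2) (v 3)
    have h0 := fun x => form_self β (v x)
    rcases fin_four i with rfl | rfl | rfl | rfl <;> rcases fin_four j with rfl | rfl | rfl | rfl <;> grind

/-- The volume form `Ω` as a linear function on the exterior algebra (zero outside degree `4`). -/
def volumeFunctional (β : V [⋀^Fin 2]→ₗ[ℂ] ℂ) : ExteriorAlgebra ℂ V →ₗ[ℂ] ℂ :=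
  ExteriorAlgebra.liftAlternating (Pi.single 4 (volumeForm β))

/-- The symmetric inner product `⟨w₁, w₂⟩ = Ω(w₁ ∧ w₂)` on `W`. -/
def innerW (β : V [⋀^Fin 2]→ₗ[ℂ] ℂ) : LinearMap.BilinForm ℂ (W β) :=
  LinearMap.mk₂ ℂ
    (fun w₁ w₂ => volumeFunctional β
      (((w₁ : ⋀[ℂ]^2 V) : ExteriorAlgebra ℂ V) * ((w₂ : ⋀[ℂ]^2 V) : ExteriorAlgebra ℂ V)))
    (by intros; simp [add_mul]) (by intros; simp)
    (by intros; simp [mul_add]) (by intros; simp)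

/-- The decomposable `2`-vector `x ∧ y`. -/
def wedge (x y : V) : ⋀[ℂ]^2 V := exteriorPower.ιMulti ℂ 2 ![x, y]

/-- A contact curve in `ℙ(V)` for the contact structure defined by `β`: the contact plane at `[v]`
is the image in `T_[v] ℙ(V)` of the subspace of `V` on which `β(v, ·)` vanishes. -/
def IsContactCurve (β : V [⋀^Fin 2]→ₗ[ℂ] ℂ) (f : P1 → ℙ ℂ V) : Prop :=
  IsHolomorphic f ∧ ∀ (j : Fin 2) (z₀ : ℂ) (F : ℂ → V) (F' : V),
    IsLocalLift f j z₀ F → HasVecDerivAt F F' z₀ → β ![F z₀, F'] = 0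

/-- The holomorphic curve `g` in `ℙ(W)` is the associated curve `f₂ = [F ∧ F']` of the curve
`f = [F]` in `ℙ(V)` (wherever `F ∧ F'` vanishes, `f₂` is the holomorphic extension). -/
def IsSecondAssociatedCurve (β : V [⋀^Fin 2]→ₗ[ℂ] ℂ) (f : P1 → ℙ ℂ V) (g : P1 → ℙ ℂ (W β)) :
    Prop :=
  IsHolomorphic g ∧ ∀ (j : Fin 2) (z₀ : ℂ) (F : ℂ → V) (F' : V),
    IsLocalLift f j z₀ F → HasVecDerivAt F F' z₀ → wedge (F z₀) F' ≠ 0 →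
      IsClassOf (Projectivization.map (W β).subtype (W β).injective_subtype (g (chart j z₀)))
        (wedge (F z₀) F')

end Klein

end NullCurve

end

/-! A hyperplane that is nowhere tangent to a curve `g` of degree `6` pulls back to a binary form
with six simple zeros. Scaling the local lifts to agree with this form on the chosen functional
glues them to one lift in each affine coordinate, and Liouville's theorem makes the lift a
polynomial `G = c 0 + z c 1 + ⋯ + z ^ 6 c 6` (`exists_hasForm_of_hasDegree`). Nullity then becomes a
list of linear relations between the products `B (c k) (c l)`, one family for each weight `k + l`
(`NullGram`).

The invariant that decides everything is `⟨G'', G''⟩ / 24`, which by these relations has degree only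
`4` in `z` (`quartic`). If it vanished identically, all the `c k` would span a totally isotropic
subspace of a nondegenerate `5`-space, of dimension at most `2`, and `g` would be linear. So it is
not zero, and the `c k` span `W`. Put a zero of the quartic at `z = 0`. Then all products of weight
below `5` vanish. A nonzero product of weight `5` would make `c 0, …, c 5` independent, which is
impossible in dimension `5`, so the zero is at least double; by a similar argument with weight `6`
it is exactly double (`NullGram.h05_eq_zero`, `NullGram.middle_ne_zero`). Hence the quartic has two
double zeros, which are moved to `0` and `∞` (`exists_reparam`).

Now only products of weight `6` survive. Dimension `5` again forces one of the pairs `(c 1, c 5)`,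
`(c 2, c 4)` to have product zero; its two members are then orthogonal to everything, hence zero
(`NullGram.isNormal`). The two relations of weight `6` determine the remaining Gram matrix up to a
factor, so each of the two cases is a single curve up to similarity (`projEquiv_of_isNormal`).

The models are the associated curves of the two contact curves, computed in a basis of `V` where `β`
is antidiagonal. They are inequivalent because every point of the unbranched one lies on a
hyperplane meeting the curve in six distinct points, while a hyperplane through a branch point meets
the curve there with multiplicity at least two. -/

noncomputable section

namespace NullCurve

/-! ### Affine coordinates on the projective line -/

section Charts

/-- The vector representing the point with coordinate `z` in the `j`-th affine coordinate. -/
def chartVec (j : Fin 2) (z : ℂ) : Fin 2 → ℂ := if j = 0 then ![1, z] else ![z, 1]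

theorem chartVec_ne_zero (j : Fin 2) (z : ℂ) : chartVec j z ≠ 0 := by
  intro h
  unfold chartVec at h
  split_ifs at h
  · simpa using congrFun h 0
  · simpa using congrFun h 1

theorem chart_eq_mk (j : Fin 2) (z : ℂ) :
    chart j z = Projectivization.mk ℂ (chartVec j z) (chartVec_ne_zero j z) := rfl

theorem chart_zero_injective : Function.Injective (chart 0) := by
  intro z w h
  rw [chart_eq_mk, chart_eq_mk, Projectivization.mk_eq_mk_iff'] at h
  obtain ⟨a, ha⟩ := h
  have h0 := congrFun ha 0
  have h1 := congrFun ha 1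
  simp [chartVec] at h0 h1
  rw [← h1, h0, one_mul]

theorem chart_zero_ne_infty (z : ℂ) : chart 0 z ≠ chart 1 0 := by
  intro h
  rw [chart_eq_mk, chart_eq_mk, Projectivization.mk_eq_mk_iff'] at h
  obtain ⟨a, ha⟩ := h
  have h0 := congrFun ha 0
  simp [chartVec] at h0

theorem chart_one_eq (z : ℂ) (hz : z ≠ 0) : chart 1 z = chart 0 z⁻¹ := by
  rw [chart_eq_mk, chart_eq_mk, Projectivization.mk_eq_mk_iff']
  refine ⟨z, ?_⟩
  ext i
  fin_cases i <;> simp [chartVec, hz]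

theorem exists_chart (p : P1) : (∃ z, p = chart 0 z) ∨ p = chart 1 0 := by
  induction p using Projectivization.ind with
  | h v hv =>
    by_cases h0 : v 0 = 0
    · right
      rw [chart_eq_mk, Projectivization.mk_eq_mk_iff']
      refine ⟨v 1, ?_⟩
      ext i
      fin_cases i <;> simp [chartVec, h0]
    · left
      refine ⟨v 1 / v 0, ?_⟩
      rw [chart_eq_mk, Projectivization.mk_eq_mk_iff']
      refine ⟨v 0, ?_⟩
      ext i
      fin_cases i <;> simp [chartVec, mul_div_cancel₀, h0]

end Charts

/-! ### Representatives of points and comparison of local lifts -/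

section Classes

variable {E : Type*} [AddCommGroup E] [Module ℂ E] {p : ℙ ℂ E} {v w : E}

theorem IsClassOf.ne_zero (h : IsClassOf p v) : v ≠ 0 := h.1

theorem IsClassOf.smul (h : IsClassOf p v) {a : ℂ} (ha : a ≠ 0) : IsClassOf p (a • v) := by
  obtain ⟨hv, rfl⟩ := h
  refine ⟨smul_ne_zero ha hv, ?_⟩
  rw [Projectivization.mk_eq_mk_iff']
  exact ⟨a⁻¹, by rw [smul_smul, inv_mul_cancel₀ ha, one_smul]⟩

theorem IsClassOf.exists_smul (h : IsClassOf p v) (h' : IsClassOf p w) :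
    ∃ a : ℂ, a ≠ 0 ∧ w = a • v := by
  obtain ⟨hv, rfl⟩ := h
  obtain ⟨hw, h⟩ := h'
  rw [Projectivization.mk_eq_mk_iff'] at h
  obtain ⟨a, rfl⟩ := h
  have ha : a ≠ 0 := by rintro rfl; simp at hv
  exact ⟨a⁻¹, inv_ne_zero ha, by rw [smul_smul, inv_mul_cancel₀ ha, one_smul]⟩

theorem IsClassOf.eq {q : ℙ ℂ E} (h : IsClassOf p v) (h' : IsClassOf q v) : p = q := by
  obtain ⟨hv, rfl⟩ := h
  obtain ⟨hw, rfl⟩ := h'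
  rfl

theorem isClassOf_rep (p : ℙ ℂ E) : IsClassOf p p.rep :=
  ⟨p.rep_nonzero, (Projectivization.mk_rep p).symm⟩

theorem IsClassOf.submodule_eq (h : IsClassOf p v) : p.submodule = Submodule.span ℂ {v} := by
  obtain ⟨hv, rfl⟩ := h
  exact Projectivization.submodule_mk v hv

theorem IsClassOf.le_ker_iff (h : IsClassOf p v) (l : Module.Dual ℂ E) :
    p.submodule ≤ LinearMap.ker l ↔ l v = 0 := by
  rw [h.submodule_eq, Submodule.span_singleton_le_iff_mem, LinearMap.mem_ker]

theorem IsClassOf.map {E' : Type*} [AddCommGroup E'] [Module ℂ E'] (h : IsClassOf p v)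
    (T : E →ₗ[ℂ] E') (hT : Function.Injective T) :
    IsClassOf (Projectivization.map T hT p) (T v) := by
  obtain ⟨hv, rfl⟩ := h
  exact ⟨by simpa using hT.ne hv, rfl⟩

theorem exists_dual_eq_one (hv : v ≠ 0) : ∃ l : Module.Dual ℂ E, l v = 1 := by
  obtain ⟨l, hl⟩ : ∃ l : Module.Dual ℂ E, l v ≠ 0 := by
    by_contra! h
    exact hv ((Module.forall_dual_apply_eq_zero_iff ℂ v).1 h)
  exact ⟨(l v)⁻¹ • l, by simp [hl]⟩

theorem eq_of_forall_dual (h : ∀ l : Module.Dual ℂ E, l v = l w) : v = w := by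
  rw [← sub_eq_zero]
  refine (Module.forall_dual_apply_eq_zero_iff ℂ _).1 fun l => ?_
  rw [map_sub, h, sub_self]

/-- Two local lifts of a curve differ by a nonvanishing factor. -/
theorem IsLocalLift.exists_factor {f : P1 → ℙ ℂ E} {j : Fin 2} {z₀ : ℂ} {F H : ℂ → E} {F' H' : E}
    (hF : IsLocalLift f j z₀ F) (hH : IsLocalLift f j z₀ H)
    (hF' : HasVecDerivAt F F' z₀) (hH' : HasVecDerivAt H H' z₀) :
    ∃ a a' : ℂ, a ≠ 0 ∧ F z₀ = a • H z₀ ∧ F' = a' • H z₀ + a • H' := by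
  obtain ⟨m, hm⟩ := exists_dual_eq_one hH.2.self_of_nhds.ne_zero
  have hm0 : m (H z₀) ≠ 0 := by simp [hm]
  set a : ℂ → ℂ := fun z => m (F z) / m (H z) with ha
  have hcont : ∀ᶠ z in 𝓝 z₀, m (H z) ≠ 0 := (hH.1 m).continuousAt.eventually_ne hm0
  have hev : ∀ᶠ z in 𝓝 z₀, F z = a z • H z := by
    filter_upwards [hF.2, hH.2, hcont] with z h1 h2 h3
    obtain ⟨b, -, hb⟩ := h2.exists_smul h1
    have : a z = b := by simp [ha, hb, h3]
    rw [this, hb]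
  have hder := (hF' m).div (hH' m) hm0
  have ha0 : a z₀ ≠ 0 := by
    intro h
    have := hF.2.self_of_nhds.ne_zero
    rw [hev.self_of_nhds, h, zero_smul] at this
    exact this rfl
  refine ⟨a z₀, (m F' * m (H z₀) - m (F z₀) * m H') / m (H z₀) ^ 2, ha0, hev.self_of_nhds, ?_⟩
  refine eq_of_forall_dual fun l => ?_
  have h1 := (hder.mul (hH' l)).congr_of_eventuallyEq
    (f₁ := fun z => l (F z)) (by
      filter_upwards [hev] with z hz
      rw [hz, map_smul, smul_eq_mul]; rfl)
  have := (hF' l).unique h1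
  rw [this, map_add, map_smul, map_smul, smul_eq_mul, smul_eq_mul]
  rfl

end Classes

/-! ### Polynomial curves and their reparametrizations -/

section Forms

variable {E : Type*} [AddCommGroup E] [Module ℂ E]

/-- The polynomial curve `z ↦ c₀ + z c₁ + ⋯ + zⁿ cₙ`. -/
def polyCurve (n : ℕ) (c : ℕ → E) (z : ℂ) : E := ∑ k ∈ Finset.range (n + 1), z ^ k • c k

/-- The derivative of `polyCurve n c`. -/
def polyDeriv (n : ℕ) (c : ℕ → E) (z : ℂ) : E :=
  ∑ k ∈ Finset.range (n + 1), ((k : ℂ) * z ^ (k - 1)) • c k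

/-- The coefficients in the opposite order. -/
def reverse (n : ℕ) (c : ℕ → E) : ℕ → E := fun k => c (n - k)

/-- The coefficients of a polynomial curve in the `j`-th affine coordinate. -/
def chartCoeff (n : ℕ) (j : Fin 2) (c : ℕ → E) : ℕ → E := if j = 0 then c else reverse n c

/-- The curve `g` is given by the polynomial of degree at most `n` with coefficients `c`. -/
def HasForm (g : P1 → ℙ ℂ E) (n : ℕ) (c : ℕ → E) : Prop :=
  ∀ (j : Fin 2) (z : ℂ), IsClassOf (g (chart j z)) (polyCurve n (chartCoeff n j c) z)

theorem polyCurve_zero (n : ℕ) (c : ℕ → E) : polyCurve n c 0 = c 0 := by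
  rw [polyCurve, Finset.sum_range_succ']
  simp

theorem polyCurve_reverse (n : ℕ) (c : ℕ → E) {z : ℂ} (hz : z ≠ 0) :
    polyCurve n (reverse n c) z = z ^ n • polyCurve n c z⁻¹ := by
  rw [polyCurve, polyCurve, ← Finset.sum_range_reflect, Finset.smul_sum]
  refine Finset.sum_congr rfl fun k hk => ?_
  have hk : k ≤ n := Nat.lt_succ_iff.1 (Finset.mem_range.1 hk)
  have h1 : n + 1 - 1 - k = n - k := by omega
  rw [h1, reverse, Nat.sub_sub_self hk, smul_smul, pow_sub₀ z hz hk, inv_pow]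

theorem map_polyCurve {E' : Type*} [AddCommGroup E'] [Module ℂ E'] (T : E →ₗ[ℂ] E') (n : ℕ)
    (c : ℕ → E) (z : ℂ) : T (polyCurve n c z) = polyCurve n (fun k => T (c k)) z := by
  simp [polyCurve]

theorem hasVecDerivAt_polyCurve (n : ℕ) (c : ℕ → E) (z : ℂ) :
    HasVecDerivAt (polyCurve n c) (polyDeriv n c z) z := by
  intro l
  simp only [polyCurve, polyDeriv, map_sum, map_smul, smul_eq_mul]
  refine HasDerivAt.fun_sum fun k _ => ?_
  exact (hasDerivAt_pow k z).mul_const _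

theorem analyticAt_polyCurve (n : ℕ) (c : ℕ → E) (z : ℂ) (l : Module.Dual ℂ E) :
    AnalyticAt ℂ (fun z => l (polyCurve n c z)) z := by
  simp only [polyCurve, map_sum, map_smul, smul_eq_mul]
  fun_prop

theorem HasForm.isLocalLift {g : P1 → ℙ ℂ E} {n : ℕ} {c : ℕ → E} (h : HasForm g n c) (j : Fin 2)
    (z : ℂ) : IsLocalLift g j z (polyCurve n (chartCoeff n j c)) :=
  ⟨fun l => analyticAt_polyCurve n _ z l, Filter.Eventually.of_forall fun w => h j w⟩

theorem HasForm.isHolomorphic {g : P1 → ℙ ℂ E} {n : ℕ} {c : ℕ → E} (h : HasForm g n c) :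
    IsHolomorphic g := fun j z => ⟨_, h.isLocalLift j z⟩

theorem HasForm.zero {g : P1 → ℙ ℂ E} {n : ℕ} {c : ℕ → E} (h : HasForm g n c) (z : ℂ) :
    IsClassOf (g (chart 0 z)) (polyCurve n c z) := h 0 z

theorem HasForm.infty {g : P1 → ℙ ℂ E} {n : ℕ} {c : ℕ → E} (h : HasForm g n c) :
    IsClassOf (g (chart 1 0)) (c n) := by
  have := h 1 0
  rw [polyCurve_zero] at this
  exact this

theorem hasForm_of_affine {g : P1 → ℙ ℂ E} {n : ℕ} {c : ℕ → E}
    (h : ∀ z, IsClassOf (g (chart 0 z)) (polyCurve n c z)) (h' : IsClassOf (g (chart 1 0)) (c n)) :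
    HasForm g n c := by
  intro j z
  rcases Fin.exists_fin_two.1 ⟨j, rfl⟩ with rfl | rfl
  · exact h z
  · change IsClassOf _ (polyCurve n (reverse n c) z)
    by_cases hz : z = 0
    · subst hz
      rw [polyCurve_zero]
      exact h'
    · rw [chart_one_eq z hz, polyCurve_reverse n c hz]
      exact (h _).smul (pow_ne_zero _ hz)

/-- Only the value at `∞` needs a separate condition: the lift in the second coordinate is `z ^ n`
times the first one away from its centre, where it equals `c n`. -/
theorem exists_hasForm {n : ℕ} {c : ℕ → E} (h : ∀ z, polyCurve n c z ≠ 0) (h' : c n ≠ 0) :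
    ∃ g : P1 → ℙ ℂ E, HasForm g n c := by
  have : ∀ p : P1, ∃ q : ℙ ℂ E, (∀ z, p = chart 0 z → IsClassOf q (polyCurve n c z)) ∧
      (p = chart 1 0 → IsClassOf q (c n)) := by
    intro p
    rcases exists_chart p with ⟨z, rfl⟩ | rfl
    · refine ⟨Projectivization.mk ℂ _ (h z), fun w hw => ?_, fun hw => ?_⟩
      · obtain rfl := chart_zero_injective hw
        exact ⟨h z, rfl⟩
      · exact absurd hw (chart_zero_ne_infty z)
    · refine ⟨Projectivization.mk ℂ _ h', fun w hw => ?_, fun _ => ⟨h', rfl⟩⟩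
      exact absurd hw.symm (chart_zero_ne_infty w)
  choose g hg using this
  exact ⟨g, hasForm_of_affine (fun z => (hg _).1 z rfl) ((hg _).2 rfl)⟩

theorem HasForm.unique {g g' : P1 → ℙ ℂ E} {n : ℕ} {c : ℕ → E} (h : HasForm g n c)
    (h' : HasForm g' n c) : g = g' := by
  funext p
  rcases exists_chart p with ⟨z, rfl⟩ | rfl
  · exact (h.zero z).eq (h'.zero z)
  · exact h.infty.eq h'.infty

theorem HasForm.map {E' : Type*} [AddCommGroup E'] [Module ℂ E'] {g : P1 → ℙ ℂ E} {n : ℕ}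
    {c : ℕ → E} (h : HasForm g n c) (T : E →ₗ[ℂ] E') (hT : Function.Injective T) :
    HasForm (fun p => Projectivization.map T hT (g p)) n (fun k => T (c k)) := by
  refine hasForm_of_affine (fun z => ?_) (h.infty.map T hT)
  rw [← map_polyCurve]
  exact (h.zero z).map T hT

theorem HasForm.swap {g : P1 → ℙ ℂ E} {n : ℕ} {c : ℕ → E} (h : HasForm g n c) :
    ∃ A : (Fin 2 → ℂ) ≃ₗ[ℂ] (Fin 2 → ℂ),
      HasForm (fun p => g (Projectivization.map A.toLinearMap A.injective p)) n (reverse n c) := by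
  refine ⟨LinearEquiv.funCongrLeft ℂ ℂ (Equiv.swap 0 1), hasForm_of_affine (fun z => ?_) ?_⟩
  · change IsClassOf _ (polyCurve n (chartCoeff n 1 c) z)
    convert h 1 z using 2
    rw [chart_eq_mk, chart_eq_mk, Projectivization.map_mk, Projectivization.mk_eq_mk_iff']
    refine ⟨1, ?_⟩
    ext i
    fin_cases i <;> simp [chartVec, LinearEquiv.funCongrLeft]
  · rw [reverse, Nat.sub_self, ← polyCurve_zero n c]
    change IsClassOf _ (polyCurve n (chartCoeff n 0 c) 0)
    convert h 0 0 using 2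
    rw [chart_eq_mk, chart_eq_mk, Projectivization.map_mk, Projectivization.mk_eq_mk_iff']
    refine ⟨1, ?_⟩
    ext i
    fin_cases i <;> simp [chartVec, LinearEquiv.funCongrLeft]

/-- The translation `z ↦ z + t` of the affine coordinate. -/
def translation (t : ℂ) : (Fin 2 → ℂ) ≃ₗ[ℂ] (Fin 2 → ℂ) where
  toFun v := ![v 0, v 1 + t * v 0]
  invFun v := ![v 0, v 1 - t * v 0]
  map_add' v w := by ext i; fin_cases i <;> simp; ring
  map_smul' a v := by ext i; fin_cases i <;> simp; ring
  left_inv v := by ext i; fin_cases i <;> simp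
  right_inv v := by ext i; fin_cases i <;> simp

theorem map_translation_chart_zero (t z : ℂ) :
    Projectivization.map (translation t).toLinearMap (translation t).injective (chart 0 z) =
      chart 0 (z + t) := by
  rw [chart_eq_mk, chart_eq_mk, Projectivization.map_mk, Projectivization.mk_eq_mk_iff']
  refine ⟨1, ?_⟩
  ext i
  fin_cases i <;> simp [chartVec, translation]

theorem map_translation_infty (t : ℂ) :
    Projectivization.map (translation t).toLinearMap (translation t).injective (chart 1 0) =
      chart 1 0 := by
  rw [chart_eq_mk, Projectivization.map_mk, Projectivization.mk_eq_mk_iff']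
  refine ⟨1, ?_⟩
  ext i
  fin_cases i <;> simp [chartVec, translation]

end Forms

/-! ### The Gram relations of a null sextic and its quartic form -/

section Gram

variable {E : Type*} [AddCommGroup E] [Module ℂ E]

theorem coeff_eq_zero_of_forall {n : ℕ} {a : ℕ → ℂ}
    (h : ∀ z : ℂ, ∑ k ∈ Finset.range (n + 1), z ^ k * a k = 0) {k : ℕ} (hk : k ≤ n) : a k = 0 := by
  have h0 : ∑ k ∈ Finset.range (n + 1), Polynomial.C (a k) * Polynomial.X ^ k = 0 := by
    refine Polynomial.funext fun z => ?_
    rw [Polynomial.eval_finsetSum, Polynomial.eval_zero, ← h z]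
    exact Finset.sum_congr rfl fun k _ => by
      rw [Polynomial.eval_mul, Polynomial.eval_C, Polynomial.eval_pow, Polynomial.eval_X, mul_comm]
  have h1 := congrArg (fun p => Polynomial.coeff p k) h0
  simpa [Polynomial.finsetSum_coeff, Polynomial.coeff_X_pow, Nat.lt_succ_iff, hk] using h1

theorem quadratic_coeff_eq_zero {n : ℕ} {m : ℕ → ℕ → ℂ}
    (h : ∀ z : ℂ, ∑ k ∈ Finset.range (n + 1), ∑ l ∈ Finset.range (n + 1), z ^ (k + l) * m k l = 0)
    {s : ℕ} (hs : s ≤ 2 * n) :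
    ∑ k ∈ Finset.range (n + 1), ∑ l ∈ Finset.range (n + 1), (if k + l = s then m k l else 0) = 0 := by
  refine coeff_eq_zero_of_forall (n := 2 * n) (a := fun s => ∑ k ∈ Finset.range (n + 1),
    ∑ l ∈ Finset.range (n + 1), (if k + l = s then m k l else 0)) (fun z => ?_) hs
  refine Eq.trans ?_ (h z)
  simp only [Finset.mul_sum]
  rw [Finset.sum_comm]
  refine Finset.sum_congr rfl fun k hk => ?_
  rw [Finset.sum_comm]
  refine Finset.sum_congr rfl fun l hl => ?_
  rw [Finset.mem_range] at hk hl
  have : k + l ∈ Finset.range (2 * n + 1) := by rw [Finset.mem_range]; omega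
  rw [Finset.sum_eq_single_of_mem _ this (fun s _ hs => by rw [if_neg hs.symm, mul_zero])]
  rw [if_pos rfl]

/-- The relations between the inner products of the coefficients of a polynomial curve of
degree `6` which express that it is null. -/
structure NullGram (B : LinearMap.BilinForm ℂ E) (c : ℕ → E) : Prop where
  h00 : B (c 0) (c 0) = 0
  h01 : B (c 0) (c 1) = 0
  h02 : B (c 0) (c 2) = 0
  h11 : B (c 1) (c 1) = 0
  h03 : B (c 0) (c 3) = 0
  h12 : B (c 1) (c 2) = 0
  h13 : B (c 1) (c 3) = -4 * B (c 0) (c 4)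
  h22 : B (c 2) (c 2) = 6 * B (c 0) (c 4)
  h14 : B (c 1) (c 4) = -3 * B (c 0) (c 5)
  h23 : B (c 2) (c 3) = 2 * B (c 0) (c 5)
  h6 : 2 * B (c 0) (c 6) + 2 * B (c 1) (c 5) + 2 * B (c 2) (c 4) + B (c 3) (c 3) = 0
  h6' : 10 * B (c 1) (c 5) + 16 * B (c 2) (c 4) + 9 * B (c 3) (c 3) = 0
  h25 : B (c 2) (c 5) = -3 * B (c 1) (c 6)
  h34 : B (c 3) (c 4) = 2 * B (c 1) (c 6)
  h35 : B (c 3) (c 5) = -4 * B (c 2) (c 6)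
  h44 : B (c 4) (c 4) = 6 * B (c 2) (c 6)
  h36 : B (c 3) (c 6) = 0
  h45 : B (c 4) (c 5) = 0
  h46 : B (c 4) (c 6) = 0
  h55 : B (c 5) (c 5) = 0
  h56 : B (c 5) (c 6) = 0
  h66 : B (c 6) (c 6) = 0

variable {B : LinearMap.BilinForm ℂ E} {c : ℕ → E}

/-- Comparing coefficients gives two linear equations between the products of each weight `k + l`.
They kill all products of weight at most `3` or at least `9`, leave one free product in the weights
`4`, `5`, `7`, `8`, and leave two relations between four products in weight `6`. The condition `⟨G,
G'⟩ = 0` follows from `⟨G, G⟩ = 0` by differentiation and adds nothing. -/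
theorem nullGram_of_forall (hB : ∀ x y, B x y = B y x)
    (h : ∀ z, B (polyCurve 6 c z) (polyCurve 6 c z) = 0)
    (h' : ∀ z, B (polyDeriv 6 c z) (polyDeriv 6 c z) = 0) : NullGram B c := by
  have e : ∀ s ≤ 12, _ := fun s hs => quadratic_coeff_eq_zero (n := 6)
    (m := fun k l => B (c k) (c l)) (s := s) (fun z => by
      rw [← h z]
      simp only [polyCurve, map_sum, LinearMap.sum_apply, map_smul, LinearMap.smul_apply,
        smul_eq_mul]
      rw [Finset.sum_comm]
      refine Finset.sum_congr rfl fun k _ => ?_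
      rw [Finset.mul_sum]
      refine Finset.sum_congr rfl fun l _ => ?_
      ring) hs
  -- The derivative has degree `5` with coefficients `(k + 1) • c (k + 1)`, so the coefficient of `z
  -- ^ s` here collects the products of weight `s + 2`; the names `b2, …, b10` below record this
  -- weight.
  have e' : ∀ s ≤ 10, _ := fun s hs => quadratic_coeff_eq_zero (n := 5)
    (m := fun k l => ((k + 1 : ℕ) * (l + 1 : ℕ) : ℂ) * B (c (k + 1)) (c (l + 1))) (s := s)
    (fun z => by
      rw [← h' z]
      simp only [polyDeriv, map_sum, LinearMap.sum_apply, map_smul, LinearMap.smul_apply,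
        smul_eq_mul]
      rw [Finset.sum_comm, Finset.sum_range_succ' _ 6]
      simp only [Nat.cast_zero, zero_mul, add_zero]
      refine Finset.sum_congr rfl fun k _ => ?_
      rw [Finset.sum_range_succ' _ 6]
      simp only [Nat.cast_zero, zero_mul, add_zero, Nat.add_sub_cancel]
      rw [Finset.mul_sum]
      refine Finset.sum_congr rfl fun l _ => ?_
      ring) hs
  have a0 := e 0 (by norm_num)
  have a1 := e 1 (by norm_num)
  have a2 := e 2 (by norm_num)
  have a3 := e 3 (by norm_num)
  have a4 := e 4 (by norm_num)
  have a5 := e 5 (by norm_num)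
  have a6 := e 6 (by norm_num)
  have a7 := e 7 (by norm_num)
  have a8 := e 8 (by norm_num)
  have a9 := e 9 (by norm_num)
  have a10 := e 10 (by norm_num)
  have a11 := e 11 (by norm_num)
  have a12 := e 12 (by norm_num)
  have b2 := e' 0 (by norm_num)
  have b3 := e' 1 (by norm_num)
  have b4 := e' 2 (by norm_num)
  have b5 := e' 3 (by norm_num)
  have b6 := e' 4 (by norm_num)
  have b7 := e' 5 (by norm_num)
  have b8 := e' 6 (by norm_num)
  have b9 := e' 7 (by norm_num)
  have b10 := e' 8 (by norm_num)
  clear e e' h h'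
  simp [Finset.sum_range_succ] at a0 a1 a2 a3 a4 a5 a6 a7 a8 a9 a10 a11 a12
  simp [Finset.sum_range_succ] at b2 b3 b4 b5 b6 b7 b8 b9 b10
  simp only [hB (c 1) (c 0), hB (c 2) (c 0), hB (c 2) (c 1), hB (c 3) (c 0), hB (c 3) (c 1),
    hB (c 3) (c 2), hB (c 4) (c 0), hB (c 4) (c 1), hB (c 4) (c 2), hB (c 4) (c 3),
    hB (c 5) (c 0), hB (c 5) (c 1), hB (c 5) (c 2), hB (c 5) (c 3), hB (c 5) (c 4),
    hB (c 6) (c 0), hB (c 6) (c 1), hB (c 6) (c 2), hB (c 6) (c 3), hB (c 6) (c 4),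
    hB (c 6) (c 5)] at a0 a1 a2 a3 a4 a5 a6 a7 a8 a9 a10 a11 a12 b2 b3 b4 b5 b6 b7 b8 b9 b10
  have r02 : B (c 0) (c 2) = 0 := by linear_combination a2 / 2 - b2 / 2
  have r12 : B (c 1) (c 2) = 0 := by linear_combination b3 / 4
  have r46 : B (c 4) (c 6) = 0 := by linear_combination 25 / 2 * (a10 - b10 / 25)
  have r45 : B (c 4) (c 5) = 0 := by linear_combination 1 / 4 * (b9 - 18 * a9)
  constructor <;> first | assumption | skip
  all_goals grind

/-- The converse of the coefficient comparison. It carries the Gram relations through translations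
of the parameter and shows that the model curves are null. -/
theorem NullGram.forall (hB : ∀ x y, B x y = B y x) (h : NullGram B c) (z : ℂ) :
    B (polyCurve 6 c z) (polyCurve 6 c z) = 0 ∧ B (polyCurve 6 c z) (polyDeriv 6 c z) = 0 ∧
      B (polyDeriv 6 c z) (polyDeriv 6 c z) = 0 := by
  obtain ⟨h00, h01, h02, h11, h03, h12, h13, h22, h14, h23, h6, h6', h25, h34, h35, h44, h36, h45,
    h46, h55, h56, h66⟩ := h
  have h06 : B (c 0) (c 6) = -B (c 1) (c 5) - B (c 2) (c 4) - B (c 3) (c 3) / 2 := by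
    linear_combination h6 / 2
  have h15 : B (c 1) (c 5) = - 8 / 5 * B (c 2) (c 4) - 9 / 10 * B (c 3) (c 3) := by
    linear_combination h6' / 10
  simp only [polyCurve, polyDeriv, Finset.sum_range_succ, Finset.range_zero, Finset.sum_empty,
    zero_add, map_add, map_smul, LinearMap.add_apply, LinearMap.smul_apply, smul_eq_mul]
  simp only [hB (c 1) (c 0), hB (c 2) (c 0), hB (c 2) (c 1), hB (c 3) (c 0), hB (c 3) (c 1),
    hB (c 3) (c 2), hB (c 4) (c 0), hB (c 4) (c 1), hB (c 4) (c 2), hB (c 4) (c 3),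
    hB (c 5) (c 0), hB (c 5) (c 1), hB (c 5) (c 2), hB (c 5) (c 3), hB (c 5) (c 4),
    hB (c 6) (c 0), hB (c 6) (c 1), hB (c 6) (c 2), hB (c 6) (c 3), hB (c 6) (c 4),
    hB (c 6) (c 5)]
  simp only [h00, h01, h02, h11, h03, h12, h13, h22, h14, h23, h25, h34, h35, h44, h36, h45,
    h46, h55, h56, h66, h06, h15]
  norm_num
  refine ⟨?_, ?_, ?_⟩ <;> ring

theorem NullGram.reverse (hB : ∀ x y, B x y = B y x) (h : NullGram B c) :
    NullGram B (reverse 6 c) := by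
  obtain ⟨h00, h01, h02, h11, h03, h12, h13, h22, h14, h23, h6, h6', h25, h34, h35, h44, h36, h45,
    h46, h55, h56, h66⟩ := h
  constructor <;> simp only [NullCurve.reverse] <;> norm_num <;> grind

/-- The coefficients of the polynomial curve `z ↦ polyCurve n c (z + t)`. -/
def shift (n : ℕ) (t : ℂ) (c : ℕ → E) (k : ℕ) : E :=
  ∑ j ∈ Finset.range (n + 1), ((j.choose k : ℂ) * t ^ (j - k)) • c j

theorem polyCurve_shift (n : ℕ) (t : ℂ) (c : ℕ → E) (z : ℂ) :
    polyCurve n (shift n t c) z = polyCurve n c (z + t) := by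
  simp only [polyCurve, shift, Finset.smul_sum, smul_smul]
  rw [Finset.sum_comm]
  refine Finset.sum_congr rfl fun j hj => ?_
  rw [← Finset.sum_smul, add_pow]
  congr 1
  have hj : j + 1 ≤ n + 1 := Finset.mem_range.1 hj
  rw [← Finset.sum_subset (Finset.range_mono hj)]
  · exact Finset.sum_congr rfl fun k _ => by ring
  · intro k _ hk
    rw [Nat.choose_eq_zero_of_lt (by rw [Finset.mem_range] at hk; omega)]
    simp

theorem polyDeriv_shift (n : ℕ) (t : ℂ) (c : ℕ → E) (z : ℂ) :
    polyDeriv n (shift n t c) z = polyDeriv n c (z + t) := by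
  refine eq_of_forall_dual fun l => ?_
  have h1 := hasVecDerivAt_polyCurve n (shift n t c) z l
  have h2 := (hasVecDerivAt_polyCurve n c (z + t) l).comp_add_const z t
  simp only [polyCurve_shift] at h1
  exact h1.unique h2

theorem shift_top (n : ℕ) (t : ℂ) (c : ℕ → E) : shift n t c n = c n := by
  rw [shift, Finset.sum_range_succ, Finset.sum_eq_zero]
  · simp
  · intro j hj
    rw [Nat.choose_eq_zero_of_lt (Finset.mem_range.1 hj)]
    simp

theorem NullGram.shift (hB : ∀ x y, B x y = B y x) (h : NullGram B c) (t : ℂ) :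
    NullGram B (shift 6 t c) :=
  nullGram_of_forall hB (fun z => by rw [polyCurve_shift]; exact (h.forall hB _).1)
    (fun z => by rw [polyDeriv_shift]; exact (h.forall hB _).2.2)

theorem HasForm.translate {g : P1 → ℙ ℂ E} {n : ℕ} (h : HasForm g n c) (t : ℂ) :
    HasForm (fun p => g (Projectivization.map (translation t).toLinearMap
      (translation t).injective p)) n (NullCurve.shift n t c) := by
  refine hasForm_of_affine (fun z => ?_) ?_
  · rw [map_translation_chart_zero, polyCurve_shift]
    exact h.zero _
  · rw [map_translation_infty, shift_top]
    exact h.infty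

/-- The quartic form `⟨G'', G''⟩ / 24` attached to a null curve of degree `6`. -/
def quartic (B : LinearMap.BilinForm ℂ E) (c : ℕ → E) (t : ℂ) : ℂ :=
  B (c 0) (c 4) + 2 * B (c 0) (c 5) * t + (2 * B (c 2) (c 4) + 3 / 2 * B (c 3) (c 3)) * t ^ 2
    + 2 * B (c 1) (c 6) * t ^ 3 + B (c 2) (c 6) * t ^ 4

/-- The second coefficient after translation is `G'' / 2` at `t`, and the weight `4` relation `h22`
turns its square into `6` times the product sought. So a zero of the quartic at `t` becomes the
vanishing of `B (c 0) (c 4)` for the translated curve. -/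
theorem NullGram.shift_zero_four (hB : ∀ x y, B x y = B y x) (h : NullGram B c) (t : ℂ) :
    B (NullCurve.shift 6 t c 0) (NullCurve.shift 6 t c 4) = quartic B c t := by
  have h2 : B (NullCurve.shift 6 t c 2) (NullCurve.shift 6 t c 2) = 6 * quartic B c t := by
    have hs : NullCurve.shift 6 t c 2 = c 2 + (3 * t) • c 3 + (6 * t ^ 2) • c 4
        + (10 * t ^ 3) • c 5 + (15 * t ^ 4) • c 6 := by
      simp [NullCurve.shift, Finset.sum_range_succ, Nat.choose]
    rw [hs, quartic]
    simp only [map_add, map_smul, LinearMap.add_apply, LinearMap.smul_apply, smul_eq_mul]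
    simp only [hB (c 3) (c 2), hB (c 4) (c 2), hB (c 4) (c 3), hB (c 5) (c 2), hB (c 5) (c 3),
      hB (c 5) (c 4), hB (c 6) (c 2), hB (c 6) (c 3), hB (c 6) (c 4), hB (c 6) (c 5), h.h22, h.h23,
      h.h25, h.h34, h.h35, h.h36, h.h44, h.h45, h.h46, h.h55, h.h56, h.h66]
    ring
  have := (h.shift hB t).h22
  linear_combination (h2 - this) / 6

end Gram

/-! ### Dimension arguments on the Gram matrix -/

section Gram

variable {E : Type*} [AddCommGroup E] [Module ℂ E] {B : LinearMap.BilinForm ℂ E} {c : ℕ → E}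

/-- The functionals `B (x i)` evaluated on the `y j` form a triangular matrix with nonzero
determinant. -/
theorem linearIndependent_of_triangular {n : ℕ} (x y : Fin n → E)
    (h0 : ∀ i j, j < i → B (x i) (y j) = 0) (h1 : ∀ i, B (x i) (y i) ≠ 0) :
    LinearIndependent ℂ y := by
  let M : Matrix (Fin n) (Fin n) ℂ := Matrix.of fun i j => B (x i) (y j)
  have hM : IsUnit M := by
    rw [Matrix.isUnit_iff_isUnit_det,
      Matrix.det_of_isUpperTriangular (M := M) (fun i j hij => h0 i j hij),
      isUnit_iff_ne_zero]
    exact Finset.prod_ne_zero_iff.2 fun i _ => h1 i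
  have := Matrix.linearIndependent_cols_iff_isUnit.2 hM
  exact LinearIndependent.of_comp (LinearMap.pi fun i => B (x i)) this

/-- Pairing each `c (idx i)` with its partner of complementary weight `c (s - idx i)` makes the Gram
matrix triangular. Against dimension `5`, this is the source of all the vanishing results below. -/
theorem linearIndependent_of_antitriangular {n s : ℕ} {idx : Fin n → ℕ} (hidx : StrictMono idx)
    (hle : ∀ i, idx i ≤ s)
    (h0 : ∀ k l, k + l < s → B (c k) (c l) = 0) (h1 : ∀ i, B (c (s - idx i)) (c (idx i)) ≠ 0) :
    LinearIndependent ℂ (fun i => c (idx i)) := by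
  refine linearIndependent_of_triangular (fun i => c (s - idx i)) _ (fun i j hij => h0 _ _ ?_) h1
  have := hidx hij
  have := hle i
  omega

theorem NullGram.eq_zero_of_lt_four (hB : ∀ x y, B x y = B y x) (h : NullGram B c) (k l : ℕ)
    (hkl : k + l < 4) : B (c k) (c l) = 0 := by
  have hk : k < 4 := by omega
  have hl : l < 4 := by omega
  have := h.h00
  have := h.h01
  have := h.h02
  have := h.h03
  have := h.h11
  have := h.h12
  interval_cases k <;> interval_cases l <;> first | omega | assumption | (rw [hB]; assumption)

theorem NullGram.eq_zero_of_lt_five (hB : ∀ x y, B x y = B y x) (h : NullGram B c)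
    (h04 : B (c 0) (c 4) = 0) (k l : ℕ) (hkl : k + l < 5) : B (c k) (c l) = 0 := by
  rcases Nat.lt_or_ge (k + l) 4 with h4 | h4
  · exact h.eq_zero_of_lt_four hB k l h4
  have hk : k < 5 := by omega
  have hl : l = 4 - k := by omega
  subst hl
  have h13 := h.h13
  have h22 := h.h22
  rw [h04, mul_zero] at h13 h22
  interval_cases k <;> first | assumption | (rw [hB]; assumption)

theorem NullGram.eq_zero_of_lt_six (hB : ∀ x y, B x y = B y x) (h : NullGram B c)
    (h04 : B (c 0) (c 4) = 0) (h05 : B (c 0) (c 5) = 0) (k l : ℕ) (hkl : k + l < 6) :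
    B (c k) (c l) = 0 := by
  rcases Nat.lt_or_ge (k + l) 5 with h5 | h5
  · exact h.eq_zero_of_lt_five hB h04 k l h5
  have hk : k < 6 := by omega
  have hl : l = 5 - k := by omega
  subst hl
  have h14 := h.h14
  have h23 := h.h23
  rw [h05, mul_zero] at h14 h23
  interval_cases k <;> first | assumption | (rw [hB]; assumption)

/-- The products of weight `4` are the multiples `1, -4, 6, -4, 1` of `B (c 0) (c 4)`, and all those
of lower weight vanish. -/
theorem NullGram.linearIndependent (hB : ∀ x y, B x y = B y x) (h : NullGram B c)
    (h04 : B (c 0) (c 4) ≠ 0) : LinearIndependent ℂ (fun i : Fin 5 => c i) := by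
  refine linearIndependent_of_antitriangular (s := 4) (fun i j hij => hij) (fun i => by omega)
    (h.eq_zero_of_lt_four hB) fun i => ?_
  have h13 := h.h13
  have h22 := h.h22
  fin_cases i <;> norm_num <;> grind

variable (hE : Module.finrank ℂ E = 5)
include hE

theorem card_le_of_linearIndependent {n : ℕ} {v : Fin n → E} (hv : LinearIndependent ℂ v) :
    n ≤ 5 := by
  have : Module.Finite ℂ E := Module.finite_of_finrank_pos (by omega)
  have := hv.fintype_card_le_finrank
  rwa [Fintype.card_fin, hE] at this

/-- The products of weight `5` are nonzero multiples of `B (c 0) (c 5)`; were it nonzero, `c 0, …, c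
5` would be six independent vectors. In terms of the quartic, a zero at the origin is at least
double. -/
theorem NullGram.h05_eq_zero (hB : ∀ x y, B x y = B y x) (h : NullGram B c)
    (h04 : B (c 0) (c 4) = 0) : B (c 0) (c 5) = 0 := by
  by_contra h05
  have := card_le_of_linearIndependent hE (linearIndependent_of_antitriangular (c := c) (s := 5)
    (idx := fun i : Fin 6 => i) (fun i j hij => hij) (fun i => by omega)
    (h.eq_zero_of_lt_five hB h04) fun i => by
      have h14 := h.h14
      have h23 := h.h23
      fin_cases i <;> norm_num <;> grind)
  omega

/-- Together with `he`, the two relations of weight `6` make every product of weight `6` a nonzero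
multiple of `B (c 3) (c 3)`. If that were nonzero, all seven coefficients would be independent. -/
theorem NullGram.h33_eq_zero (hB : ∀ x y, B x y = B y x) (h : NullGram B c)
    (h04 : B (c 0) (c 4) = 0) (he : 3 * B (c 3) (c 3) + 4 * B (c 2) (c 4) = 0) :
    B (c 3) (c 3) = 0 := by
  by_contra h33
  have h05 := h.h05_eq_zero hE hB h04
  have := card_le_of_linearIndependent hE (linearIndependent_of_antitriangular (c := c) (s := 6)
    (idx := fun i : Fin 7 => i) (fun i j hij => hij) (fun i => by omega)
    (h.eq_zero_of_lt_six hB h04 h05) fun i => by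
      have h6 := h.h6
      have h6' := h.h6'
      fin_cases i <;> norm_num <;> grind)
  omega

/-- The expression is twice the coefficient of `t ^ 2` in the quartic, so a zero at the origin is
exactly double. Otherwise every product of weight `6` vanishes too, and `c 0` is orthogonal to all
the coefficients. -/
theorem NullGram.middle_ne_zero (hB : ∀ x y, B x y = B y x) (h : NullGram B c)
    (hN : ∀ w, (∀ k ≤ 6, B w (c k) = 0) → w = 0) (h0 : c 0 ≠ 0)
    (h04 : B (c 0) (c 4) = 0) : 3 * B (c 3) (c 3) + 4 * B (c 2) (c 4) ≠ 0 := by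
  intro he
  have h33 := h.h33_eq_zero hE hB h04 he
  have h05 := h.h05_eq_zero hE hB h04
  refine h0 (hN _ fun k hk => ?_)
  have h00 := h.h00
  have h01 := h.h01
  have h02 := h.h02
  have h03 := h.h03
  have h6 := h.h6
  have h6' := h.h6'
  interval_cases k <;> grind

/-- Nonlinearity excludes subspaces of dimension exactly `2`, so a smaller span has to be enlarged.
-/
theorem exists_le_finrank_eq_two (U : Submodule ℂ E) (hU : Module.finrank ℂ U ≤ 2) :
    ∃ L : Submodule ℂ E, U ≤ L ∧ Module.finrank ℂ L = 2 := by
  have : Module.Finite ℂ E := Module.finite_of_finrank_pos (by omega)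
  have step : ∀ U : Submodule ℂ E, Module.finrank ℂ U < 5 →
      ∃ L, U ≤ L ∧ Module.finrank ℂ L = Module.finrank ℂ U + 1 := by
    intro U hU
    obtain ⟨x, hx⟩ : ∃ x, x ∉ U := by
      by_contra! h
      rw [(Submodule.eq_top_iff'.2 h), finrank_top, hE] at hU
      exact lt_irrefl _ hU
    refine ⟨U ⊔ ℂ ∙ x, le_sup_left, le_antisymm ?_ ?_⟩
    · exact (Submodule.finrank_add_le_finrank_add_finrank _ _).trans
        (Nat.add_le_add_left (finrank_span_singleton (by rintro rfl; exact hx U.zero_mem)).le _)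
    · refine Submodule.finrank_lt_finrank_of_lt (lt_of_le_of_ne le_sup_left fun h => hx ?_)
      rw [h]
      exact le_sup_right (a := U) (Submodule.mem_span_singleton_self x)
  obtain h2 | h2 | h2 : Module.finrank ℂ U = 0 ∨ Module.finrank ℂ U = 1 ∨
      Module.finrank ℂ U = 2 := by omega
  · obtain ⟨L, hL, h3⟩ := step U (by omega)
    obtain ⟨L', hL', h4⟩ := step L (by omega)
    exact ⟨L', hL.trans hL', by omega⟩
  · obtain ⟨L, hL, h3⟩ := step U (by omega)
    exact ⟨L, hL, by omega⟩
  · exact ⟨U, le_rfl, h2⟩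

theorem NullGram.exists_quartic_ne_zero (hB : ∀ x y, B x y = B y x) (h : NullGram B c)
    (hnd : ∀ w, (∀ u, B w u = 0) → w = 0)
    (hc : ¬ ∃ L : Submodule ℂ E, Module.finrank ℂ L = 2 ∧ ∀ k ≤ 6, c k ∈ L) :
    ∃ t, quartic B c t ≠ 0 := by
  by_contra! hq
  have : Module.Finite ℂ E := Module.finite_of_finrank_pos (by omega)
  let a : ℕ → ℂ := fun k => if k = 0 then B (c 0) (c 4) else if k = 1 then 2 * B (c 0) (c 5) else
    if k = 2 then 2 * B (c 2) (c 4) + 3 / 2 * B (c 3) (c 3) else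
    if k = 3 then 2 * B (c 1) (c 6) else B (c 2) (c 6)
  have ha : ∀ k ≤ 4, a k = 0 := fun k hk => coeff_eq_zero_of_forall (n := 4) (fun z => by
    rw [← hq z]
    simp [Finset.sum_range_succ, a, quartic]
    ring) hk
  have h04 : B (c 0) (c 4) = 0 := by simpa [a] using ha 0 (by norm_num)
  have h05 : B (c 0) (c 5) = 0 := by simpa [a] using ha 1 (by norm_num)
  have he : 2 * B (c 2) (c 4) + 3 / 2 * B (c 3) (c 3) = 0 := by simpa [a] using ha 2 (by norm_num)
  have h16 : B (c 1) (c 6) = 0 := by simpa [a] using ha 3 (by norm_num)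
  have h26 : B (c 2) (c 6) = 0 := by simpa [a] using ha 4 (by norm_num)
  have h33 := h.h33_eq_zero hE hB h04 (by linear_combination 2 * he)
  have hall : ∀ k ≤ 6, ∀ l ≤ 6, B (c k) (c l) = 0 := by
    have hlt : ∀ k l, k ≤ l → l ≤ 6 → B (c k) (c l) = 0 := by
      obtain ⟨h00, h01, h02, h11, h03, h12, h13, h22, h14, h23, h6, h6', h25, h34, h35, h44, h36,
        h45, h46, h55, h56, h66⟩ := h
      intro k l hkl hl
      interval_cases l <;> interval_cases k <;> grind
    intro k hk l hl
    rcases le_total k l with hkl | hkl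
    · exact hlt k l hkl hl
    · rw [hB]
      exact hlt l k hkl hk
  -- All products vanish, so `U` is totally isotropic: it lies in its orthogonal, of dimension `5 -
  -- dim U`, whence `dim U ≤ 2`.
  let U := Submodule.span ℂ {v | ∃ k ≤ 6, v = c k}
  have hU : U ≤ B.orthogonal U := by
    refine Submodule.span_le.2 ?_
    rintro _ ⟨k, hk, rfl⟩
    refine LinearMap.BilinForm.mem_orthogonal_iff.2 fun u hu => ?_
    change B u (c k) = 0
    have : U ≤ LinearMap.ker (B (c k)) := by
      refine Submodule.span_le.2 ?_
      rintro _ ⟨l, hl, rfl⟩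
      exact hall k hk l hl
    rw [hB]
    exact this hu
  have hB0 : B.Nondegenerate :=
    ⟨fun x hx => hnd x hx, fun y hy => hnd y fun u => by rw [hB]; exact hy u⟩
  have h1 := LinearMap.BilinForm.finrank_orthogonal hB0 U
  have h2 := Submodule.finrank_mono hU
  have h3 := Submodule.finrank_le U
  obtain ⟨L, hL, hL2⟩ := exists_le_finrank_eq_two hE U (by omega)
  exact hc ⟨L, hL2, fun k hk => hL (Submodule.subset_span ⟨k, hk, rfl⟩)⟩

end Gram

/-! ### Reduction to the two normal forms -/

section Normal

variable {E : Type*} [AddCommGroup E] [Module ℂ E] {B : LinearMap.BilinForm ℂ E} {c : ℕ → E}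

theorem exists_root_of_coeff_ne_zero {n k : ℕ} {a : ℕ → ℂ} (hk : k ≠ 0) (hkn : k ≤ n)
    (ha : a k ≠ 0) : ∃ z : ℂ, ∑ k ∈ Finset.range (n + 1), z ^ k * a k = 0 := by
  set p : Polynomial ℂ := ∑ k ∈ Finset.range (n + 1), Polynomial.C (a k) * Polynomial.X ^ k with hp
  have hc : p.coeff k = a k := by
    simp [hp, Polynomial.finsetSum_coeff, Polynomial.coeff_X_pow, hkn]
  obtain ⟨z, hz⟩ := IsAlgClosed.exists_root p fun h => by
    rw [Polynomial.eq_C_of_degree_eq_zero h, Polynomial.coeff_C_of_ne_zero hk] at hc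
    exact ha hc.symm
  refine ⟨z, ?_⟩
  rw [Polynomial.IsRoot, hp, Polynomial.eval_finsetSum] at hz
  rw [← hz]
  refine Finset.sum_congr rfl fun k _ => ?_
  rw [Polynomial.eval_mul, Polynomial.eval_C, Polynomial.eval_pow, Polynomial.eval_X, mul_comm]

theorem exists_quartic_eq_zero
    (h : 2 * B (c 2) (c 4) + 3 / 2 * B (c 3) (c 3) ≠ 0 ∨ B (c 2) (c 6) ≠ 0) :
    ∃ t, quartic B c t = 0 := by
  let a : ℕ → ℂ := fun k => if k = 0 then B (c 0) (c 4) else if k = 1 then 2 * B (c 0) (c 5) else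
    if k = 2 then 2 * B (c 2) (c 4) + 3 / 2 * B (c 3) (c 3) else
    if k = 3 then 2 * B (c 1) (c 6) else B (c 2) (c 6)
  have key : ∀ t, ∑ k ∈ Finset.range (4 + 1), t ^ k * a k = quartic B c t := fun t => by
    simp [Finset.sum_range_succ, a, quartic]
    ring
  obtain ⟨t, ht⟩ : ∃ t : ℂ, ∑ k ∈ Finset.range (4 + 1), t ^ k * a k = 0 := by
    rcases h with h | h
    · exact exists_root_of_coeff_ne_zero (k := 2) (by norm_num) (by norm_num) (by simpa [a] using h)
    · exact exists_root_of_coeff_ne_zero (k := 4) (by norm_num) (by norm_num) (by simpa [a] using h)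
  exact ⟨t, by rw [← key, ht]⟩

/-- No nonzero vector is orthogonal to all the coefficients of the polynomial curve. -/
def IsFull (B : LinearMap.BilinForm ℂ E) (c : ℕ → E) : Prop :=
  ∀ w, (∀ k ≤ 6, B w (c k) = 0) → w = 0

theorem IsFull.reverse (h : IsFull B c) : IsFull B (reverse 6 c) := by
  refine fun w hw => h w fun k hk => ?_
  have := hw (6 - k) (by omega)
  rwa [NullCurve.reverse, Nat.sub_sub_self hk] at this

theorem IsFull.shift (h : IsFull B c) (t : ℂ) : IsFull B (shift 6 t c) := by
  refine fun w hw => h w fun k hk => ?_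
  refine coeff_eq_zero_of_forall (a := fun k => B w (c k)) (fun z => ?_) hk
  have h1 := map_polyCurve (B w) 6 (NullCurve.shift 6 t c) (z - t)
  rw [polyCurve_shift, sub_add_cancel, map_polyCurve] at h1
  simp only [polyCurve, smul_eq_mul] at h1
  rw [h1]
  refine Finset.sum_eq_zero fun k hk => ?_
  rw [hw k (Nat.lt_succ_iff.1 (Finset.mem_range.1 hk)), mul_zero]

/-- Where the quartic does not vanish, the first five Taylor coefficients form a basis of the space.
-/
theorem NullGram.isFull (hE : Module.finrank ℂ E = 5) (hB : ∀ x y, B x y = B y x)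
    (hnd : ∀ w, (∀ u, B w u = 0) → w = 0) (h : NullGram B c) {t : ℂ} (ht : quartic B c t ≠ 0) :
    IsFull B c := by
  rw [← h.shift_zero_four hB] at ht
  have hli := (h.shift hB t).linearIndependent hB ht
  let b := basisOfLinearIndependentOfCardEqFinrank hli (by rw [Fintype.card_fin, hE])
  refine fun w hw => hnd w fun u => ?_
  have : B w = 0 := b.ext fun i => by
    rw [coe_basisOfLinearIndependentOfCardEqFinrank, LinearMap.zero_apply, NullCurve.shift, map_sum]
    refine Finset.sum_eq_zero fun k hk => ?_
    rw [map_smul, hw k (Nat.lt_succ_iff.1 (Finset.mem_range.1 hk)), smul_zero]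
  rw [this, LinearMap.zero_apply]

variable (hE : Module.finrank ℂ E = 5) (hB : ∀ x y, B x y = B y x)
include hE hB

-- `B (d 2) (d 6)` is the coefficient of `t ^ 4` in the quartic, so its vanishing means a zero at
-- `∞`. If it is not already zero, the quartic has a finite root; a translation takes the root to
-- `0` and the swap of coordinates takes it to `∞`.
omit hE in
theorem exists_reparam_infty {g : P1 → ℙ ℂ E} (hg : HasForm g 6 c) (h : NullGram B c)
    (hN : IsFull B c) :
    ∃ (A : (Fin 2 → ℂ) ≃ₗ[ℂ] (Fin 2 → ℂ)) (d : ℕ → E),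
      HasForm (fun p => g (Projectivization.map A.toLinearMap A.injective p)) 6 d ∧
      NullGram B d ∧ IsFull B d ∧ B (d 2) (d 6) = 0 := by
  by_cases h26 : B (c 2) (c 6) = 0
  · refine ⟨LinearEquiv.refl ℂ _, c, ?_, h, hN, h26⟩
    convert hg using 3 with p
    exact congrFun Projectivization.map_id p
  · obtain ⟨t, ht⟩ := exists_quartic_eq_zero (Or.inr h26)
    obtain ⟨A, hA⟩ := (hg.translate t).swap
    refine ⟨A.trans (translation t), _, ?_, (h.shift hB t).reverse hB, (hN.shift t).reverse, ?_⟩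
    · convert hA using 3 with p
      exact congrFun (Projectivization.map_comp A.toLinearMap A.injective
        (translation t).toLinearMap (translation t).injective (A.trans (translation t)).injective) p
    · rw [reverse, reverse, hB]
      exact (h.shift_zero_four hB t).trans ht

theorem exists_reparam {g : P1 → ℙ ℂ E} (hg : HasForm g 6 c) (h : NullGram B c)
    (hN : IsFull B c) :
    ∃ (A : (Fin 2 → ℂ) ≃ₗ[ℂ] (Fin 2 → ℂ)) (d : ℕ → E),
      HasForm (fun p => g (Projectivization.map A.toLinearMap A.injective p)) 6 d ∧
      NullGram B d ∧ IsFull B d ∧ B (d 0) (d 4) = 0 ∧ B (d 2) (d 6) = 0 := by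
  obtain ⟨A, d, hd, hd1, hd2, hd3⟩ := exists_reparam_infty hB hg h hN
  -- Seen from `∞`, the zero there is exactly double. So the coefficient of `t ^ 2` is nonzero and
  -- the quartic has a finite root as well, which is translated to `0` while `∞` stays fixed.
  have he := (hd1.reverse hB).middle_ne_zero hE hB hd2.reverse hd.infty.ne_zero
    (by rw [reverse, reverse, hB]; exact hd3)
  simp only [reverse] at he
  norm_num at he
  rw [hB (d 4)] at he
  obtain ⟨t, ht⟩ := exists_quartic_eq_zero (B := B) (c := d)
    (Or.inl fun h => he (by linear_combination 2 * h))
  refine ⟨(translation t).trans A, _, ?_, hd1.shift hB t, hd2.shift t, ?_, ?_⟩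
  · convert hd.translate t using 3 with p
    exact congrFun (Projectivization.map_comp (translation t).toLinearMap (translation t).injective
      A.toLinearMap A.injective ((translation t).trans A).injective) p
  · rw [hd1.shift_zero_four hB, ht]
  · rw [shift_top]
    simp [shift, Finset.sum_range_succ, Nat.choose, hd1.h36, hd1.h46, hd1.h56, hd1.h66, hd3]

omit hE hB in
/-- The polynomial curve with coefficients `c` is `∑ᵢ z ^ (idx i) • c (idx i)`, and the inner
products of these five vectors are zero outside the antidiagonal, where they are proportional
to `γ`. -/
def IsNormal (B : LinearMap.BilinForm ℂ E) (idx : Fin 5 → ℕ) (γ : Fin 5 → ℂ) (c : ℕ → E) : Prop :=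
  (∀ k ≤ 6, (∀ i, k ≠ idx i) → c k = 0) ∧ ∃ x : ℂ, x ≠ 0 ∧
    ∀ i j, B (c (idx i)) (c (idx j)) = if j = i.rev then x * γ i else 0

/-- The exponents and inner products for `f = [1, z², z³, z⁵]`. -/
def IsNormalA (B : LinearMap.BilinForm ℂ E) (c : ℕ → E) : Prop :=
  IsNormal B ![0, 1, 3, 5, 6] ![2 / 5, -9 / 10, 1, -9 / 10, 2 / 5] c

/-- The exponents and inner products for `f = [1, z, z³, z⁴]`. -/
def IsNormalB (B : LinearMap.BilinForm ℂ E) (c : ℕ → E) : Prop :=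
  IsNormal B ![0, 2, 3, 4, 6] ![1 / 16, -9 / 16, 1, -9 / 16, 1 / 16] c

/-- With zeros of the quartic at both `0` and `∞`, every product of weight different from `6`
vanishes. The ratios in `IsNormalA` and `IsNormalB` are the solutions of `h6` and `h6'` with one of
the two side products equal to zero. -/
theorem NullGram.isNormal (h : NullGram B c) (hN : IsFull B c) (h0 : c 0 ≠ 0) (h04 : B (c 0) (c 4) = 0)
    (h26 : B (c 2) (c 6) = 0) : IsNormalA B c ∨ IsNormalB B c := by
  have he := h.middle_ne_zero hE hB hN h0 h04
  have h05 := h.h05_eq_zero hE hB h04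
  have h16 := (h.reverse hB).h05_eq_zero hE hB (by rw [NullCurve.reverse, NullCurve.reverse, hB]; exact h26)
  replace h16 : B (c 6) (c 1) = 0 := h16
  rw [hB] at h16
  have hlt := h.eq_zero_of_lt_six hB h04 h05
  -- Fullness gives `B (c 0) (c 6) ≠ 0`. If both side products were nonzero too, the six
  -- coefficients other than `c 3` would be independent.
  have hli : B (c 1) (c 5) = 0 ∨ B (c 2) (c 4) = 0 := by
    by_contra! hne
    have h06 : B (c 0) (c 6) ≠ 0 := by
      intro h06
      refine h0 (hN _ fun k hk => ?_)
      obtain rfl | hk : k = 6 ∨ k < 6 := by omega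
      · exact h06
      · exact hlt 0 k (by omega)
    have := card_le_of_linearIndependent hE (linearIndependent_of_antitriangular (c := c) (s := 6)
      (idx := ![0, 1, 2, 4, 5, 6]) (by decide) (by decide) hlt fun i => by
        fin_cases i <;> simp [hB (c 6), hB (c 5), hB (c 4) (c 2), h06, hne])
    omega
  obtain ⟨h00, h01, h02, h11, h03, h12, h13, h22, h14, h23, h6, h6', h25, h34, h35, h44, h36, h45,
    h46, h55, h56, h66⟩ := h
  rw [h04, mul_zero] at h13 h22
  rw [h05, mul_zero] at h14 h23
  rw [h16, mul_zero] at h25 h34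
  rw [h26, mul_zero] at h35 h44
  rcases hli with h15 | h24
  · right
    -- The only product of `c 1` that could survive is the one with `c 5`, so `c 1` is orthogonal to
    -- everything; the same holds for `c 5`.
    have h1 : c 1 = 0 := hN _ fun k hk => by interval_cases k <;> first | assumption | (rw [hB]; assumption)
    have h5 : c 5 = 0 := hN _ fun k hk => by interval_cases k <;> first | assumption | (rw [hB]; assumption)
    have h24 : B (c 2) (c 4) = -9 / 16 * B (c 3) (c 3) := by
      rw [h15] at h6'
      linear_combination h6' / 16
    have h06 : B (c 0) (c 6) = 1 / 16 * B (c 3) (c 3) := by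
      rw [h15, h24] at h6
      linear_combination h6 / 2
    refine ⟨fun k hk hidx => ?_, B (c 3) (c 3), fun h33 => he (by rw [h24, h33]; ring), fun i j => ?_⟩
    · have e0 := hidx 0
      have e1 := hidx 1
      have e2 := hidx 2
      have e3 := hidx 3
      have e4 := hidx 4
      interval_cases k <;> first | assumption | (simp at e0 e1 e2 e3 e4)
    · fin_cases i <;> fin_cases j <;>
        simp [Fin.rev, h00, h02, h03, h04, h06, h22, h23, h24, h26, h34, h36, h44, h46, h66,
          hB (c 6) (c 0), hB (c 6) (c 2), hB (c 6) (c 3), hB (c 6) (c 4), hB (c 4) (c 0),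
          hB (c 4) (c 2), hB (c 4) (c 3), hB (c 3) (c 0), hB (c 3) (c 2), hB (c 2) (c 0)] <;> ring
  · left
    have h2 : c 2 = 0 := hN _ fun k hk => by interval_cases k <;> first | assumption | (rw [hB]; assumption)
    have h4 : c 4 = 0 := hN _ fun k hk => by interval_cases k <;> first | assumption | (rw [hB]; assumption)
    have h15 : B (c 1) (c 5) = -9 / 10 * B (c 3) (c 3) := by
      rw [h24] at h6'
      linear_combination h6' / 10
    have h06 : B (c 0) (c 6) = 2 / 5 * B (c 3) (c 3) := by
      rw [h24, h15] at h6
      linear_combination h6 / 2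
    refine ⟨fun k hk hidx => ?_, B (c 3) (c 3), fun h33 => he (by rw [h24, h33]; ring), fun i j => ?_⟩
    · have e0 := hidx 0
      have e1 := hidx 1
      have e2 := hidx 2
      have e3 := hidx 3
      have e4 := hidx 4
      interval_cases k <;> first | assumption | (simp at e0 e1 e2 e3 e4)
    · fin_cases i <;> fin_cases j <;>
        simp [Fin.rev, h00, h01, h03, h05, h06, h11, h13, h15, h16, h35, h36, h55, h56, h66,
          hB (c 6) (c 0), hB (c 6) (c 1), hB (c 6) (c 3), hB (c 6) (c 5), hB (c 5) (c 0),
          hB (c 5) (c 1), hB (c 5) (c 3), hB (c 3) (c 0), hB (c 3) (c 1), hB (c 1) (c 0)] <;> ring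

omit hB in
theorem IsNormal.exists_basis {idx : Fin 5 → ℕ} {γ : Fin 5 → ℂ} (hγ : ∀ i, γ i ≠ 0)
    (h : IsNormal B idx γ c) : ∃ b : Module.Basis (Fin 5) ℂ E, ∀ i, b i = c (idx i) := by
  obtain ⟨-, x, hx, hx'⟩ := h
  have hli : LinearIndependent ℂ fun i => c (idx i) := by
    refine linearIndependent_of_triangular (B := B) (fun i => c (idx i.rev)) _ (fun i j hij => ?_)
      fun i => ?_
    · rw [hx', if_neg]
      rw [Fin.rev_rev]
      exact hij.ne
    · rw [hx', if_pos (Fin.rev_rev i).symm]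
      exact mul_ne_zero hx (hγ _)
  exact ⟨basisOfLinearIndependentOfCardEqFinrank hli (by rw [Fintype.card_fin, hE]), fun i => by
    rw [coe_basisOfLinearIndependentOfCardEqFinrank]⟩

omit hB in
/-- Curves in the same normal form differ by a similarity. -/
theorem IsNormal.exists_similarity {idx : Fin 5 → ℕ} {γ : Fin 5 → ℂ} (hγ : ∀ i, γ i ≠ 0)
    {c' : ℕ → E} (h : IsNormal B idx γ c) (h' : IsNormal B idx γ c') :
    ∃ T : E ≃ₗ[ℂ] E, (∀ k ≤ 6, T (c k) = c' k) ∧ ∀ w, B (T w) (T w) = 0 ↔ B w w = 0 := by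
  obtain ⟨b, hb⟩ := h.exists_basis hE hγ
  obtain ⟨b', hb'⟩ := h'.exists_basis hE hγ
  obtain ⟨h0, x, hx, hx'⟩ := h
  obtain ⟨h0', y, hy, hy'⟩ := h'
  let T := b.equiv b' (Equiv.refl _)
  have hT : ∀ i, T (c (idx i)) = c' (idx i) := fun i => by
    rw [← hb, ← hb', Module.Basis.equiv_apply, Equiv.refl_apply]
  -- Both Gram matrices are multiples of the same matrix, with factors `x` and `y`, so `T` scales
  -- the form by `y / x`.
  have hTB : B.compl₁₂ T.toLinearMap T.toLinearMap = (y / x) • B := by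
    refine LinearMap.BilinForm.ext_basis b fun i j => ?_
    simp only [LinearMap.compl₁₂_apply, LinearEquiv.coe_coe, LinearMap.smul_apply, smul_eq_mul]
    rw [hb, hb, hT, hT, hx', hy']
    split_ifs
    · field_simp
    · simp
  refine ⟨T, fun k hk => ?_, fun w => ?_⟩
  · by_cases hk' : ∀ i, k ≠ idx i
    · rw [h0 k hk hk', h0' k hk hk', map_zero]
    · push Not at hk'
      obtain ⟨i, rfl⟩ := hk'
      exact hT i
  · have := congrArg (fun b => b w w) hTB
    simp only [LinearMap.compl₁₂_apply, LinearEquiv.coe_coe, LinearMap.smul_apply, smul_eq_mul]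
      at this
    rw [this]
    simp [hx, hy]

omit hB in
theorem projEquiv_of_isNormal {idx : Fin 5 → ℕ} {γ : Fin 5 → ℂ} (hγ : ∀ i, γ i ≠ 0)
    {c' : ℕ → E} (h : IsNormal B idx γ c) (h' : IsNormal B idx γ c') {g g' : P1 → ℙ ℂ E}
    (A : (Fin 2 → ℂ) ≃ₗ[ℂ] (Fin 2 → ℂ))
    (hg : HasForm (fun p => g (Projectivization.map A.toLinearMap A.injective p)) 6 c)
    (hg' : HasForm g' 6 c') : ProjEquiv B g g' := by
  obtain ⟨T, hT, hTB⟩ := h.exists_similarity hE hγ h'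
  refine ⟨A.symm, T, hTB, fun p => ?_⟩
  have h1 := hg.map T.toLinearMap T.injective
  have h2 : HasForm g' 6 (fun k => T.toLinearMap (c k)) := by
    refine hasForm_of_affine (fun z => ?_) ?_
    · convert hg'.zero z using 1
      refine Finset.sum_congr rfl fun k hk => ?_
      change z ^ k • T (c k) = _
      rw [hT k (Nat.lt_succ_iff.1 (Finset.mem_range.1 hk))]
    · rw [LinearEquiv.coe_coe, hT 6 le_rfl]
      exact hg'.infty
  rw [h2.unique h1]
  dsimp only
  congr 2
  have := congrFun (Projectivization.map_comp A.symm.toLinearMap A.symm.injective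
    A.toLinearMap A.injective (by
      rw [← LinearEquiv.coe_trans]; exact (A.symm.trans A).injective)) p
  refine this.symm.trans ?_
  have hid : A.toLinearMap ∘ₗ A.symm.toLinearMap = LinearMap.id := by
    ext1; simp
  simp only [hid]
  exact congrFun Projectivization.map_id p

end Normal

/-! ### Holomorphic curves of finite degree are polynomial -/

section Analysis

/-- Liouville's theorem with a pole of order at most `N` at `∞`: the quotient `(f z - f 0) / z` is
again entire and has a pole of order one less. -/
theorem exists_polynomial_of_growth (N : ℕ) : ∀ {f h : ℂ → ℂ}, Differentiable ℂ f →
    ContinuousAt h 0 → (∀ᶠ w in 𝓝[≠] (0 : ℂ), w ^ N * f w⁻¹ = h w) →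
    ∃ a : ℕ → ℂ, (∀ z, f z = ∑ k ∈ Finset.range (N + 1), z ^ k * a k) ∧ a N = h 0 := by
  induction N with
  | zero =>
    intro f h hf hh hfh
    have h1 : Filter.Tendsto (fun w => f w⁻¹) (𝓝[≠] 0) (𝓝 (h 0)) :=
      (hh.tendsto.mono_left nhdsWithin_le_nhds).congr' (by
        filter_upwards [hfh] with w hw
        rw [← hw, pow_zero, one_mul])
    have h2 : Filter.Tendsto f (Bornology.cobounded ℂ) (𝓝 (h 0)) := by
      have := h1.comp Filter.tendsto_inv₀_cobounded'
      simpa [Function.comp_def] using this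
    rw [Metric.cobounded_eq_cocompact] at h2
    refine ⟨fun _ => h 0, fun z => ?_, rfl⟩
    rw [hf.apply_eq_of_tendsto_cocompact z h2]
    simp
  | succ N ih =>
    intro f h hf hh hfh
    have hd : Differentiable ℂ (dslope f 0) := by
      rw [← differentiableOn_univ, Complex.differentiableOn_dslope Filter.univ_mem]
      exact hf.differentiableOn
    -- The correction term `w ^ (N + 1) * f 0` vanishes at `w = 0`, so the leading coefficient is
    -- still `h 0`.
    obtain ⟨a, ha, haN⟩ := ih (h := fun w => h w - w ^ (N + 1) * f 0) hd (by fun_prop) (by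
      filter_upwards [hfh, self_mem_nhdsWithin] with w hw hw0
      have hw0 : w ≠ 0 := hw0
      rw [← hw, dslope_of_ne _ (inv_ne_zero hw0), slope_def_field, sub_zero]
      field_simp
      ring)
    refine ⟨fun k => if k = 0 then f 0 else a (k - 1), fun z => ?_, ?_⟩
    · rw [Finset.sum_range_succ']
      simp only [Nat.add_eq_zero_iff, one_ne_zero, and_false, if_false, if_true, pow_zero, one_mul,
        Nat.add_sub_cancel]
      have h1 := sub_smul_dslope f 0 z
      rw [ha z, sub_zero, smul_eq_mul, Finset.mul_sum] at h1
      rw [← sub_eq_iff_eq_add, ← h1]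
      exact Finset.sum_congr rfl fun k _ => by ring
    · simp [haN]

theorem exists_analyticAt_factor {f : ℂ → ℂ} {z₀ : ℂ} (hf : AnalyticAt ℂ f z₀) (h0 : f z₀ = 0) :
    ∃ ν : ℂ → ℂ, AnalyticAt ℂ ν z₀ ∧ ν z₀ = deriv f z₀ ∧ ∀ z, f z = (z - z₀) * ν z := by
  obtain ⟨p, hp⟩ := hf
  refine ⟨dslope f z₀, ⟨_, hp.has_fpower_series_dslope_fslope⟩, dslope_same f z₀, fun z => ?_⟩
  have := sub_smul_dslope f z₀ z
  rw [h0, sub_zero] at this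
  exact this.symm

/-- The area form of the plane. -/
def det₂ (v w : Fin 2 → ℂ) : ℂ := v 0 * w 1 - v 1 * w 0

theorem det₂_chartVec_eq_zero_iff (j : Fin 2) (z : ℂ) (p : P1) :
    det₂ (chartVec j z) p.rep = 0 ↔ chart j z = p := by
  have hp := p.rep_nonzero
  rw [← Projectivization.mk_rep p, chart_eq_mk, Projectivization.mk_eq_mk_iff']
  rw [Projectivization.mk_rep p]
  generalize p.rep = w at *
  rcases Fin.exists_fin_two.1 ⟨j, rfl⟩ with rfl | rfl
  · constructor
    · intro h
      simp [det₂, chartVec] at h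
      have hw : w = w 0 • ![1, z] := by
        ext i
        fin_cases i
        · simp
        · simp; linear_combination h
      have hw0 : w 0 ≠ 0 := by
        intro h0
        rw [h0, zero_smul] at hw
        exact hp hw
      refine ⟨(w 0)⁻¹, ?_⟩
      nth_rw 2 [hw]
      simp [chartVec, hw0]
    · rintro ⟨a, ha⟩
      rw [← ha]
      simp [det₂]; ring
  · constructor
    · intro h
      simp [det₂, chartVec] at h
      have hw : w = w 1 • ![z, 1] := by
        ext i
        fin_cases i
        · simp; linear_combination -h
        · simp
      have hw0 : w 1 ≠ 0 := by
        intro h0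
        rw [h0, zero_smul] at hw
        exact hp hw
      refine ⟨(w 1)⁻¹, ?_⟩
      nth_rw 2 [hw]
      simp [chartVec, hw0]
    · rintro ⟨a, ha⟩
      rw [← ha]
      simp [det₂]; ring

theorem det₂_chartVec_eq (j : Fin 2) {z₀ : ℂ} {w : Fin 2 → ℂ} (hw : w ≠ 0)
    (h0 : det₂ (chartVec j z₀) w = 0) :
    ∃ a : ℂ, a ≠ 0 ∧ ∀ z, det₂ (chartVec j z) w = (z - z₀) * a := by
  rcases Fin.exists_fin_two.1 ⟨j, rfl⟩ with rfl | rfl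
  · simp [det₂, chartVec] at h0 ⊢
    refine ⟨-w 0, fun h => hw ?_, fun z => by linear_combination h0⟩
    ext i
    fin_cases i
    · simpa using h
    · simp; linear_combination h0 - z₀ * h
  · simp [det₂, chartVec] at h0 ⊢
    refine ⟨w 1, fun h => hw ?_, fun z => by linear_combination h0⟩
    ext i
    fin_cases i
    · simp; linear_combination -h0 + z₀ * h
    · simpa using h

/-- The binary form with simple zeros at the points of `S`, in the `j`-th affine coordinate. -/
def zeroForm (S : Finset P1) (j : Fin 2) (z : ℂ) : ℂ := ∏ p ∈ S, det₂ (chartVec j z) p.rep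

theorem zeroForm_eq_zero_iff (S : Finset P1) (j : Fin 2) (z : ℂ) :
    zeroForm S j z = 0 ↔ chart j z ∈ S := by
  rw [zeroForm, Finset.prod_eq_zero_iff]
  simp only [det₂_chartVec_eq_zero_iff]
  exact ⟨fun ⟨p, hp, h⟩ => h ▸ hp, fun h => ⟨_, h, rfl⟩⟩

theorem analyticAt_zeroForm (S : Finset P1) (j : Fin 2) (z : ℂ) :
    AnalyticAt ℂ (zeroForm S j) z := by
  unfold zeroForm det₂ chartVec
  split_ifs
  · simp; fun_prop
  · simp; fun_prop

theorem zeroForm_zero_eq (S : Finset P1) {z : ℂ} (hz : z ≠ 0) :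
    zeroForm S 1 z = z ^ S.card * zeroForm S 0 z⁻¹ := by
  rw [zeroForm, zeroForm, ← Finset.prod_const, ← Finset.prod_mul_distrib]
  refine Finset.prod_congr rfl fun p _ => ?_
  simp [det₂, chartVec]
  field_simp

theorem exists_zeroForm_factor (S : Finset P1) {j : Fin 2} {z₀ : ℂ} (h : chart j z₀ ∈ S) :
    ∃ μ : ℂ → ℂ, AnalyticAt ℂ μ z₀ ∧ μ z₀ ≠ 0 ∧ ∀ z, zeroForm S j z = (z - z₀) * μ z := by
  classical
  obtain ⟨a, ha, ha'⟩ := det₂_chartVec_eq j (chart j z₀).rep_nonzero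
    ((det₂_chartVec_eq_zero_iff j z₀ _).2 rfl)
  refine ⟨fun z => a * zeroForm (S.erase (chart j z₀)) j z,
    analyticAt_const.mul (analyticAt_zeroForm _ _ _), ?_, fun z => ?_⟩
  · refine mul_ne_zero ha ?_
    rw [Ne, zeroForm_eq_zero_iff]
    exact Finset.notMem_erase _ _
  · rw [zeroForm, ← Finset.mul_prod_erase S _ h, ha', mul_assoc]
    rfl

theorem eventually_zeroForm_ne_zero (S : Finset P1) (j : Fin 2) (z₀ : ℂ) :
    ∀ᶠ z in 𝓝[≠] z₀, zeroForm S j z ≠ 0 := by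
  by_cases h : chart j z₀ ∈ S
  · obtain ⟨μ, hμ, hμ0, hs⟩ := exists_zeroForm_factor S h
    filter_upwards [(hμ.continuousAt.eventually_ne hμ0).filter_mono nhdsWithin_le_nhds,
      self_mem_nhdsWithin] with z hz hz0
    rw [hs]
    exact mul_ne_zero (sub_ne_zero.2 hz0) hz
  · have h0 : zeroForm S j z₀ ≠ 0 := fun h' => h ((zeroForm_eq_zero_iff S j z₀).1 h')
    exact ((analyticAt_zeroForm S j z₀).continuousAt.eventually_ne h0).filter_mono
      nhdsWithin_le_nhds

variable {E : Type*} [AddCommGroup E] [Module ℂ E]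

theorem exists_hasVecDerivAt [Module.Finite ℂ E] {F : ℂ → E} {z₀ : ℂ}
    (h : ∀ l : Module.Dual ℂ E, AnalyticAt ℂ (fun z => l (F z)) z₀) :
    ∃ F' : E, HasVecDerivAt F F' z₀ := by
  let b := Module.finBasis ℂ E
  refine ⟨∑ i, deriv (fun z => b.coord i (F z)) z₀ • b i, fun l => ?_⟩
  have h1 : (fun z => l (F z)) = fun z => ∑ i, b.coord i (F z) * l (b i) := by
    funext z
    conv_lhs => rw [← b.sum_repr (F z), map_sum]
    exact Finset.sum_congr rfl fun i _ => by rw [map_smul, smul_eq_mul, Module.Basis.coord_apply]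
  rw [h1]
  simp only [map_sum, map_smul, smul_eq_mul]
  exact HasDerivAt.fun_sum fun i _ => (h (b.coord i)).differentiableAt.hasDerivAt.mul_const _

/-- Since `l` is nowhere tangent, `l ∘ F` has simple zeros exactly at the points of `S`, as
`zeroForm` does, so their quotient is a local unit. -/
theorem exists_lift_factor [Module.Finite ℂ E] {g : P1 → ℙ ℂ E} {l : Module.Dual ℂ E}
    (hl : NowhereTangent g l) {S : Finset P1} (hS : ∀ p, p ∈ S ↔ (g p).submodule ≤ LinearMap.ker l)
    {j : Fin 2} {z₀ : ℂ} {F : ℂ → E} (hF : IsLocalLift g j z₀ F) :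
    ∃ a : ℂ → ℂ, AnalyticAt ℂ a z₀ ∧ a z₀ ≠ 0 ∧ ∀ᶠ z in 𝓝 z₀, zeroForm S j z = a z * l (F z) := by
  have hmem : chart j z₀ ∈ S ↔ l (F z₀) = 0 := by
    rw [hS, hF.2.self_of_nhds.le_ker_iff]
  by_cases h : chart j z₀ ∈ S
  · obtain ⟨F', hF'⟩ := exists_hasVecDerivAt hF.1
    obtain ⟨ν, hν, hν0, hlF⟩ := exists_analyticAt_factor (hF.1 l) (hmem.1 h)
    rw [(hF' l).deriv] at hν0
    have hν0 : ν z₀ ≠ 0 := hν0 ▸ hl j z₀ F F' hF hF' (hmem.1 h)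
    obtain ⟨μ, hμ, hμ0, hs⟩ := exists_zeroForm_factor S h
    refine ⟨fun z => μ z / ν z, hμ.div hν hν0, div_ne_zero hμ0 hν0, ?_⟩
    filter_upwards [hν.continuousAt.eventually_ne hν0] with z hz
    rw [hs, hlF]
    field_simp
  · have h1 : l (F z₀) ≠ 0 := fun h' => h (hmem.2 h')
    refine ⟨fun z => zeroForm S j z / l (F z), (analyticAt_zeroForm S j z₀).div (hF.1 l) h1,
      div_ne_zero (fun h' => h ((zeroForm_eq_zero_iff S j z₀).1 h')) h1, ?_⟩
    filter_upwards [(hF.1 l).continuousAt.eventually_ne h1] with z hz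
    field_simp

/-- Prescribing `l (K z) = zeroForm S j z` fixes the scaling of a lift wherever the form is nonzero,
so the rescaled local lifts glue. -/
theorem exists_global_lift [Module.Finite ℂ E] {g : P1 → ℙ ℂ E} (hg : IsHolomorphic g)
    {l : Module.Dual ℂ E} (hl : NowhereTangent g l) {S : Finset P1}
    (hS : ∀ p, p ∈ S ↔ (g p).submodule ≤ LinearMap.ker l) (j : Fin 2) :
    ∃ K : ℂ → E, (∀ z₀, IsLocalLift g j z₀ K) ∧ ∀ z, l (K z) = zeroForm S j z := by
  choose F hF using hg j
  choose a ha ha0 hs using fun z₀ => exists_lift_factor hl hS (hF z₀)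
  have hl' : ∀ z, l (a z z • F z z) = zeroForm S j z := fun z => by
    rw [(hs z).self_of_nhds, map_smul, smul_eq_mul]
  have hc : ∀ z, IsClassOf (g (chart j z)) (a z z • F z z) := fun z =>
    (hF z).2.self_of_nhds.smul (ha0 z)
  refine ⟨fun z => a z z • F z z, fun z₀ => ⟨fun m => ?_, .of_forall hc⟩, hl'⟩
  -- Each value of the lift uses the local lift centred at its own point. Near `z₀` it coincides
  -- with the rescaled lift centred at `z₀`: off `z₀` because `l` takes the same nonzero value on
  -- both, at `z₀` trivially.
  have key : ∀ᶠ z in 𝓝 z₀, a z z • F z z = a z₀ z • F z₀ z := by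
    have h1 := eventually_nhdsWithin_iff.1 (eventually_zeroForm_ne_zero S j z₀)
    filter_upwards [(hF z₀).2, hs z₀, h1] with z h2 h3 h4
    by_cases hz : z = z₀
    · rw [hz]
    · have h5 := h4 hz
      obtain ⟨b, -, hb⟩ := h2.exists_smul (hc z)
      have h6 := hl' z
      rw [hb, map_smul, smul_eq_mul, h3] at h6
      have h7 : l (F z₀ z) ≠ 0 := by
        intro h
        rw [h3, h, mul_zero] at h5
        exact h5 rfl
      rw [hb, mul_right_cancel₀ h7 h6]
  refine ((ha z₀).mul ((hF z₀).1 m)).congr ?_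
  filter_upwards [key] with z hz
  rw [hz, map_smul, smul_eq_mul]
  rfl

/-- The normalised lifts in the two coordinates differ by the transition factor `w ^ n` of a binary
form of degree `n`, where `n` is the number of points of `S`. So each coordinate of the first lift
has a pole of order at most `n` at `∞`. -/
theorem exists_hasForm_of_hasDegree [Module.Finite ℂ E] {g : P1 → ℙ ℂ E} (hg : IsHolomorphic g)
    {n : ℕ} (hn : HasDegree g n) : ∃ c : ℕ → E, HasForm g n c := by
  obtain ⟨⟨l, hl0, hl⟩, hcard⟩ := hn
  have hS := hcard l hl0 hl
  have hfin : {p : P1 | (g p).submodule ≤ LinearMap.ker l}.Finite :=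
    Set.finite_of_encard_eq_coe hS
  obtain ⟨S, hSS⟩ := hfin.exists_finset
  have hSn : S.card = n := by
    have : {p : P1 | (g p).submodule ≤ LinearMap.ker l} = (S : Set P1) := by
      ext p; simp [hSS]
    rw [this, Set.encard_coe_eq_coe_finsetCard] at hS
    exact_mod_cast hS
  have hSmem : ∀ p, p ∈ S ↔ (g p).submodule ≤ LinearMap.ker l := fun p => (hSS p).trans Iff.rfl
  obtain ⟨K, hK, hlK⟩ := exists_global_lift hg hl hSmem 0
  obtain ⟨K₁, hK₁, hlK₁⟩ := exists_global_lift hg hl hSmem 1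
  have hrel : ∀ᶠ w in 𝓝[≠] (0 : ℂ), w ^ n • K w⁻¹ = K₁ w := by
    filter_upwards [eventually_zeroForm_ne_zero S 1 0, self_mem_nhdsWithin] with w hw hw0
    have hw0 : w ≠ 0 := hw0
    have h1 := (hK w⁻¹).2.self_of_nhds
    have h2 := (hK₁ w).2.self_of_nhds
    rw [chart_one_eq w hw0] at h2
    obtain ⟨b, -, hb⟩ := h1.exists_smul h2
    have h3 := hlK₁ w
    rw [hb, map_smul, smul_eq_mul, hlK, zeroForm_zero_eq S hw0, hSn] at h3
    rw [zeroForm_zero_eq S hw0] at hw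
    rw [hb, mul_right_cancel₀ (right_ne_zero_of_mul hw) h3]
  let b := Module.finBasis ℂ E
  have hcoord : ∀ i, ∃ a : ℕ → ℂ, (∀ z, b.coord i (K z) = ∑ k ∈ Finset.range (n + 1), z ^ k * a k) ∧
      a n = b.coord i (K₁ 0) := fun i => by
    refine exists_polynomial_of_growth n (f := fun z => b.coord i (K z))
      (h := fun z => b.coord i (K₁ z)) (fun z => ((hK z).1 _).differentiableAt)
      ((hK₁ 0).1 _).continuousAt ?_
    filter_upwards [hrel] with w hw
    rw [← hw, map_smul, smul_eq_mul]
  choose a ha ha' using hcoord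
  refine ⟨fun k => ∑ i, a i k • b i, hasForm_of_affine (fun z => ?_) ?_⟩
  · convert (hK z).2.self_of_nhds using 1
    rw [← b.sum_repr (K z), polyCurve]
    simp only [Finset.smul_sum, smul_smul]
    rw [Finset.sum_comm]
    refine Finset.sum_congr rfl fun i _ => ?_
    rw [← Finset.sum_smul, ← ha]
    rfl
  · convert (hK₁ 0).2.self_of_nhds using 1
    rw [← b.sum_repr (K₁ 0)]
    refine Finset.sum_congr rfl fun i _ => ?_
    rw [ha']
    rfl

end Analysis

/-! ### Hyperplane sections, nonlinearity and nullity of polynomial curves -/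

section Degree

theorem encard_roots_le {p : Polynomial ℂ} (hp : p ≠ 0) :
    {z | p.eval z = 0}.encard ≤ p.natDegree := by
  classical
  have : {z | p.eval z = 0} = (p.roots.toFinset : Set ℂ) := by
    ext z
    simp [hp]
  rw [this, Set.encard_coe_eq_coe_finsetCard]
  exact_mod_cast (Multiset.toFinset_card_le _).trans p.card_roots'

theorem encard_roots_eq {p : Polynomial ℂ} (hp : p ≠ 0)
    (h : ∀ z, p.eval z = 0 → p.derivative.eval z ≠ 0) :
    {z | p.eval z = 0}.encard = p.natDegree := by
  classical
  have : {z | p.eval z = 0} = (p.roots.toFinset : Set ℂ) := by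
    ext z
    simp [hp]
  have hnd : p.roots.Nodup := by
    rw [Multiset.nodup_iff_count_le_one]
    intro z
    rw [Polynomial.count_roots]
    by_contra! hz
    have h1 := (Polynomial.one_lt_rootMultiplicity_iff_isRoot hp).1 hz
    exact h z h1.1 h1.2
  rw [this, Set.encard_coe_eq_coe_finsetCard, Multiset.toFinset_card_of_nodup hnd]
  exact_mod_cast IsAlgClosed.card_roots_eq_natDegree

/-- The polynomial with coefficients `a`. -/
def toPoly (n : ℕ) (a : ℕ → ℂ) : Polynomial ℂ :=
  ∑ k ∈ Finset.range (n + 1), Polynomial.C (a k) * Polynomial.X ^ k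

theorem eval_toPoly (n : ℕ) (a : ℕ → ℂ) (z : ℂ) : (toPoly n a).eval z = polyCurve n a z := by
  simp only [toPoly, polyCurve, Polynomial.eval_finsetSum, Polynomial.eval_mul, Polynomial.eval_C,
    Polynomial.eval_pow, Polynomial.eval_X, smul_eq_mul]
  exact Finset.sum_congr rfl fun k _ => mul_comm _ _

theorem eval_derivative_toPoly (n : ℕ) (a : ℕ → ℂ) (z : ℂ) :
    (toPoly n a).derivative.eval z = polyDeriv n a z := by
  simp only [toPoly, polyDeriv, Polynomial.derivative_sum, Polynomial.eval_finsetSum,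
    Polynomial.derivative_C_mul_X_pow, Polynomial.eval_mul, Polynomial.eval_C,
    Polynomial.eval_pow, Polynomial.eval_X, smul_eq_mul]
  exact Finset.sum_congr rfl fun k _ => by ring

theorem coeff_toPoly {n k : ℕ} (a : ℕ → ℂ) (hk : k ≤ n) : (toPoly n a).coeff k = a k := by
  simp [toPoly, Polynomial.finsetSum_coeff, Polynomial.coeff_X_pow, hk]

theorem natDegree_toPoly_le (n : ℕ) (a : ℕ → ℂ) : (toPoly n a).natDegree ≤ n := by
  refine Polynomial.natDegree_sum_le_of_forall_le _ _ fun k hk => ?_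
  exact (Polynomial.natDegree_C_mul_X_pow_le _ _).trans (Nat.lt_succ_iff.1 (Finset.mem_range.1 hk))

theorem natDegree_toPoly_succ_le {n : ℕ} {a : ℕ → ℂ} (h : a (n + 1) = 0) :
    (toPoly (n + 1) a).natDegree ≤ n := by
  have : toPoly (n + 1) a = toPoly n a := by
    rw [toPoly, Finset.sum_range_succ, h]
    simp [toPoly]
  rw [this]
  exact natDegree_toPoly_le n a

theorem polyDeriv_zero {E : Type*} [AddCommGroup E] [Module ℂ E] (n : ℕ) (c : ℕ → E) :
    polyDeriv (n + 1) c 0 = c 1 := by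
  rw [polyDeriv, Finset.sum_range_succ', Finset.sum_range_succ']
  simp

variable {E : Type*} [AddCommGroup E] [Module ℂ E] {g : P1 → ℙ ℂ E} {n : ℕ} {c : ℕ → E}

theorem map_polyDeriv {E' : Type*} [AddCommGroup E'] [Module ℂ E'] (T : E →ₗ[ℂ] E') (n : ℕ)
    (c : ℕ → E) (z : ℂ) : T (polyDeriv n c z) = polyDeriv n (fun k => T (c k)) z := by
  simp [polyDeriv]

theorem HasForm.encard_section (hg : HasForm g n c) (l : Module.Dual ℂ E) :
    {p : P1 | (g p).submodule ≤ LinearMap.ker l}.encard =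
      {z | polyCurve n (fun k => l (c k)) z = 0}.encard +
        {p : P1 | p = chart 1 0 ∧ l (c n) = 0}.encard := by
  have : {p : P1 | (g p).submodule ≤ LinearMap.ker l} =
      chart 0 '' {z | polyCurve n (fun k => l (c k)) z = 0} ∪
        {p : P1 | p = chart 1 0 ∧ l (c n) = 0} := by
    ext p
    simp only [Set.mem_ofPred_eq, Set.mem_union, Set.mem_image]
    rcases exists_chart p with ⟨z, rfl⟩ | rfl
    · rw [(hg.zero z).le_ker_iff, map_polyCurve]
      constructor
      · exact fun h => Or.inl ⟨z, h, rfl⟩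
      · rintro (⟨w, hw, h⟩ | ⟨h, -⟩)
        · rwa [← chart_zero_injective h]
        · exact absurd h (chart_zero_ne_infty z)
    · rw [hg.infty.le_ker_iff]
      constructor
      · exact fun h => Or.inr ⟨rfl, h⟩
      · rintro (⟨w, hw, h⟩ | ⟨-, h⟩)
        · exact absurd h (chart_zero_ne_infty w)
        · exact h
  rw [this, Set.encard_union_eq, chart_zero_injective.encard_image]
  rw [Set.disjoint_left]
  rintro _ ⟨z, -, rfl⟩ ⟨h, -⟩
  exact chart_zero_ne_infty z h

/-- The hyperplane pulls back to a form of degree `n + 1` with simple zeros. If `∞` is one of them,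
the affine polynomial has degree exactly `n` and the point at infinity makes up the count. -/
theorem HasForm.encard_section_of_nowhereTangent (hg : HasForm g (n + 1) c)
    {l : Module.Dual ℂ E} (hl : NowhereTangent g l) :
    {p : P1 | (g p).submodule ≤ LinearMap.ker l}.encard = (n + 1 : ℕ) := by
  set a : ℕ → ℂ := fun k => l (c k) with ha
  have hsimple : ∀ z, (toPoly (n + 1) a).eval z = 0 → (toPoly (n + 1) a).derivative.eval z ≠ 0 := by
    intro z hz
    rw [eval_toPoly] at hz
    rw [eval_derivative_toPoly, ← map_polyDeriv]
    refine hl 0 z _ _ (hg.isLocalLift 0 z) (hasVecDerivAt_polyCurve _ _ z) ?_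
    rw [map_polyCurve]
    exact hz
  have hinf : a (n + 1) = 0 → a n ≠ 0 := by
    intro h
    have := hl 1 0 _ _ (hg.isLocalLift 1 0) (hasVecDerivAt_polyCurve _ _ 0)
    rw [polyCurve_zero, polyDeriv_zero] at this
    exact this h
  have hne : toPoly (n + 1) a ≠ 0 := by
    intro h
    have h1 := hsimple 0
    rw [h] at h1
    simp at h1
  have hroots := encard_roots_eq hne hsimple
  simp only [eval_toPoly] at hroots
  rw [hg.encard_section, hroots]
  by_cases h : a (n + 1) = 0
  · have h1 : {p : P1 | p = chart 1 0 ∧ l (c (n + 1)) = 0} = {chart 1 0} := by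
      ext p
      exact ⟨fun hp => hp.1, fun hp => ⟨hp, h⟩⟩
    have h2 : (toPoly (n + 1) a).natDegree = n := by
      refine Polynomial.natDegree_eq_of_le_of_coeff_ne_zero (natDegree_toPoly_succ_le h) ?_
      rw [coeff_toPoly a (Nat.le_succ n)]
      exact hinf h
    rw [h1, Set.encard_singleton, h2]
    rfl
  · have h1 : {p : P1 | p = chart 1 0 ∧ l (c (n + 1)) = 0} = ∅ := by
      ext p
      exact ⟨fun hp => h hp.2, fun hp => hp.elim⟩
    have h2 : (toPoly (n + 1) a).natDegree = n + 1 := by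
      refine Polynomial.natDegree_eq_of_le_of_coeff_ne_zero (natDegree_toPoly_le _ _) ?_
      rw [coeff_toPoly a le_rfl]
      exact h
    rw [h1, Set.encard_empty, h2, add_zero]

/-- At a zero of `l`, changing the lift only multiplies the derivative of `l ∘ F` by a nonzero
factor, so it suffices to test the polynomial lift. -/
theorem HasForm.nowhereTangent (hg : HasForm g n c) {l : Module.Dual ℂ E}
    (h : ∀ j z, polyCurve n (chartCoeff n j fun k => l (c k)) z = 0 →
      polyDeriv n (chartCoeff n j fun k => l (c k)) z ≠ 0) : NowhereTangent g l := by
  intro j z F F' hF hF' hlF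
  obtain ⟨a, a', ha, h1, h2⟩ := hF.exists_factor (hg.isLocalLift j z) hF'
    (hasVecDerivAt_polyCurve _ _ z)
  have hc : (fun k => l (chartCoeff n j c k)) = chartCoeff n j fun k => l (c k) := by
    unfold chartCoeff
    split_ifs <;> rfl
  have h3 : l (polyCurve n (chartCoeff n j c) z) = 0 := by
    rw [h1, map_smul, smul_eq_mul] at hlF
    exact (mul_eq_zero.1 hlF).resolve_left ha
  have h4 := h j z
  rw [← hc, ← map_polyCurve, ← map_polyDeriv] at h4
  rw [h2, map_add, map_smul, map_smul, h3, smul_zero, zero_add]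
  exact mul_ne_zero ha (h4 h3)

theorem mem_of_forall_polyCurve_mem {L : Submodule ℂ E} (h : ∀ z, polyCurve n c z ∈ L) {k : ℕ}
    (hk : k ≤ n) : c k ∈ L := by
  by_contra hc
  obtain ⟨f, hf, hL⟩ := Submodule.exists_le_ker_of_notMem hc
  refine hf (coeff_eq_zero_of_forall (a := fun k => f (c k)) (fun z => ?_) hk)
  have := hL (h z)
  rw [LinearMap.mem_ker, map_polyCurve] at this
  exact this

theorem HasForm.not_exists_of_isNonlinear (hg : HasForm g n c) (h : IsNonlinear g) :
    ¬ ∃ L : Submodule ℂ E, Module.finrank ℂ L = 2 ∧ ∀ k ≤ n, c k ∈ L := by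
  rintro ⟨L, hL, hc⟩
  refine h ⟨L, hL, fun p => ?_⟩
  rcases exists_chart p with ⟨z, rfl⟩ | rfl
  · rw [(hg.zero z).submodule_eq, Submodule.span_singleton_le_iff_mem]
    exact Submodule.sum_mem _ fun k hk =>
      L.smul_mem _ (hc k (Nat.lt_succ_iff.1 (Finset.mem_range.1 hk)))
  · rw [hg.infty.submodule_eq, Submodule.span_singleton_le_iff_mem]
    exact hc n le_rfl

variable {B : LinearMap.BilinForm ℂ E}

theorem HasForm.nullGram (hB : ∀ x y, B x y = B y x) (hg : HasForm g 6 c)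
    (h : IsNullCurve B g) : NullGram B c := by
  have := fun z => h.null 0 z _ _ (hg.isLocalLift 0 z) (hasVecDerivAt_polyCurve _ _ z)
  exact nullGram_of_forall hB (fun z => (this z).1) (fun z => (this z).2.2)

theorem HasForm.isNullCurve (hB : ∀ x y, B x y = B y x) (hg : HasForm g 6 c) (h : NullGram B c)
    (hne : ∃ p q, g p ≠ g q) : IsNullCurve B g := by
  have hj : ∀ j, NullGram B (chartCoeff 6 j c) := fun j => by
    unfold chartCoeff
    split_ifs
    · exact h
    · exact h.reverse hB
  refine ⟨hg.isHolomorphic, hne, fun p w hw => ?_, fun j z F F' hF hF' => ?_⟩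
  · obtain ⟨j, z, rfl⟩ : ∃ j z, p = chart j z := by
      rcases exists_chart p with ⟨z, rfl⟩ | rfl
      exacts [⟨0, z, rfl⟩, ⟨1, 0, rfl⟩]
    rw [(hg j z).submodule_eq, Submodule.mem_span_singleton] at hw
    obtain ⟨a, rfl⟩ := hw
    rw [map_smul, map_smul, LinearMap.smul_apply, ((hj j).forall hB z).1, smul_zero, smul_zero]
  · obtain ⟨a, a', -, h1, h2⟩ := hF.exists_factor (hg.isLocalLift j z) hF'
      (hasVecDerivAt_polyCurve _ _ z)
    obtain ⟨e1, e2, e3⟩ := (hj j).forall hB z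
    rw [h1, h2]
    simp [e1, e2, e3, hB (polyDeriv 6 (chartCoeff 6 j c) z)]

end Degree

/-! ### Degree and branching of curves in normal form -/

section NormalCurves

variable {E : Type*} [AddCommGroup E] [Module ℂ E] {B : LinearMap.BilinForm ℂ E} {c : ℕ → E}
  {g : P1 → ℙ ℂ E} {idx : Fin 5 → ℕ} {γ : Fin 5 → ℂ} (hE : Module.finrank ℂ E = 5)

theorem IsNormal.reverse (h : IsNormal B idx γ c) (hidx : ∀ i, idx i.rev = 6 - idx i)
    (hγ : ∀ i, γ i.rev = γ i) : IsNormal B idx γ (reverse 6 c) := by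
  obtain ⟨h0, x, hx, hx'⟩ := h
  refine ⟨fun k hk hki => h0 _ (Nat.sub_le _ _) fun i hi => hki i.rev ?_, x, hx, fun i j => ?_⟩
  · rw [hidx, ← hi, Nat.sub_sub_self hk]
  · rw [NullCurve.reverse, NullCurve.reverse, ← hidx, ← hidx, hx', hγ]
    simp only [Fin.rev_inj]

include hE in
theorem IsNormal.exists_dual (h : IsNormal B idx γ c) (hγ : ∀ i, γ i ≠ 0) (x : Fin 5 → ℂ) :
    ∃ l : Module.Dual ℂ E, ∀ i, l (c (idx i)) = x i := by
  obtain ⟨b, hb⟩ := h.exists_basis hE hγ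
  exact ⟨b.constr ℂ x, fun i => by rw [← hb, Module.Basis.constr_basis]⟩

-- These functionals pull the curve back to the binomials `x + y z ^ 6`.
include hE in
theorem IsNormal.exists_dual_ends (h : IsNormal B idx γ c) (hγ : ∀ i, γ i ≠ 0) (h0 : idx 0 = 0)
    (h6 : idx 4 = 6) (x y : ℂ) : ∃ l : Module.Dual ℂ E, l (c 0) = x ∧ l (c 6) = y ∧
      ∀ k, 1 ≤ k → k ≤ 5 → l (c k) = 0 := by
  obtain ⟨l, hl⟩ := h.exists_dual hE hγ ![x, 0, 0, 0, y]
  refine ⟨l, ?_, ?_, fun k hk hk' => ?_⟩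
  · rw [← h0, hl]; rfl
  · rw [← h6, hl]; rfl
  · by_cases hki : ∀ i, k ≠ idx i
    · rw [h.1 k (by omega) hki, map_zero]
    · push Not at hki
      obtain ⟨i, rfl⟩ := hki
      have i0 : i ≠ 0 := by rintro rfl; omega
      have i4 : i ≠ 4 := by rintro rfl; omega
      rw [hl]
      fin_cases i <;> simp at i0 i4 ⊢

include hE in
theorem IsNormal.exists_hasForm (h : IsNormal B idx γ c) (hγ : ∀ i, γ i ≠ 0)
    (h0 : idx 0 = 0) (h6 : idx 4 = 6) :
    ∃ g : P1 → ℙ ℂ E, HasForm g 6 c := by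
  obtain ⟨l, hl0, hl6, hl⟩ := h.exists_dual_ends hE hγ h0 h6 1 0
  refine NullCurve.exists_hasForm (fun z hz => ?_) fun hc => ?_
  · have h1 := congrArg l hz
    rw [map_polyCurve, map_zero, polyCurve] at h1
    simp [Finset.sum_range_succ, hl0, hl6, hl] at h1
  · obtain ⟨l, -, hl6, -⟩ := h.exists_dual_ends hE hγ h0 h6 0 1
    rw [hc, map_zero] at hl6
    exact zero_ne_one hl6

include hE in
theorem HasForm.exists_ne (hg : HasForm g 6 c) (h : IsNormal B idx γ c) (hγ : ∀ i, γ i ≠ 0)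
    (h0 : idx 0 = 0) (h6 : idx 4 = 6) : ∃ p q, g p ≠ g q := by
  obtain ⟨l, hl0, hl6, -⟩ := h.exists_dual_ends hE hγ h0 h6 0 1
  refine ⟨chart 0 0, chart 1 0, fun heq => ?_⟩
  have h1 := hg.zero 0
  rw [polyCurve_zero, heq] at h1
  obtain ⟨a, -, ha⟩ := h1.exists_smul hg.infty
  rw [ha, map_smul, hl0, smul_zero] at hl6
  exact zero_ne_one hl6

include hE in
theorem HasForm.isNonlinear (hg : HasForm g 6 c) (h : IsNormal B idx γ c) (hγ : ∀ i, γ i ≠ 0)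
    (hle : ∀ i, idx i ≤ 6) : IsNonlinear g := by
  rintro ⟨L, hL, hgL⟩
  obtain ⟨b, hb⟩ := h.exists_basis hE hγ
  have hmem : ∀ z, polyCurve 6 c z ∈ L := fun z => hgL (chart 0 z) (by
    rw [(hg.zero z).submodule_eq]
    exact Submodule.mem_span_singleton_self _)
  have : (⊤ : Submodule ℂ E) ≤ L := by
    rw [← b.span_eq, Submodule.span_le]
    rintro _ ⟨i, rfl⟩
    rw [hb]
    exact mem_of_forall_polyCurve_mem hmem (hle i)
  rw [top_le_iff.1 this, finrank_top, hE] at hL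
  omega

include hE in
theorem HasForm.hasDegree (hg : HasForm g 6 c) (h : IsNormal B idx γ c) (hγ : ∀ i, γ i ≠ 0)
    (h0 : idx 0 = 0) (h6 : idx 4 = 6) : HasDegree g 6 := by
  refine ⟨?_, fun l _ hl => hg.encard_section_of_nowhereTangent hl⟩
  -- The hyperplane `z ^ 6 = 1` meets the curve transversally at the sixth roots of unity.
  obtain ⟨l, hl0, hl6, hl⟩ := h.exists_dual_ends hE hγ h0 h6 (-1) 1
  refine ⟨l, fun h => ?_, hg.nowhereTangent fun j z hz => ?_⟩
  · rw [h] at hl6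
    simp at hl6
  · have hz6 : z ^ 6 = 1 := by
      rcases Fin.exists_fin_two.1 ⟨j, rfl⟩ with rfl | rfl
      · simp [chartCoeff, polyCurve, Finset.sum_range_succ, hl0, hl6, hl] at hz
        linear_combination hz
      · simp [chartCoeff, polyCurve, Finset.sum_range_succ, hl0, hl6, hl, NullCurve.reverse] at hz
        linear_combination -hz
    have hz0 : z ≠ 0 := by rintro rfl; simp at hz6
    rcases Fin.exists_fin_two.1 ⟨j, rfl⟩ with rfl | rfl
    · simp [chartCoeff, polyDeriv, Finset.sum_range_succ, hl6, hl, hz0]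
    · simp [chartCoeff, polyDeriv, Finset.sum_range_succ, hl0, hl, NullCurve.reverse, hz0]

include hE in
/-- The branching at the centre of an affine coordinate. -/
theorem HasForm.hasBranchOrder_center (hg : HasForm g 6 c) {j : Fin 2}
    (h : IsNormal B idx γ (chartCoeff 6 j c)) (hγ : ∀ i, γ i ≠ 0)
    (hmono : StrictMono idx) (h0 : idx 0 = 0) (hle : ∀ i, idx i ≤ 6) :
    HasBranchOrder g (chart j 0) (idx 1 - 1) := by
  have h01 : idx 0 < idx 1 := hmono (by decide)
  refine ⟨3, idx, ⟨h0, hmono, j, 0, rfl, ?_⟩, by omega⟩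
  obtain ⟨b, hb⟩ := h.exists_basis hE hγ
  refine ⟨b, fun i z => z ^ idx i, fun i => ⟨by fun_prop, ?_⟩, .of_forall fun z => ?_⟩
  · rw [(by fun_prop : AnalyticAt ℂ (fun z : ℂ => z ^ idx i) 0).analyticOrderAt_eq_natCast]
    exact ⟨fun _ => 1, analyticAt_const, one_ne_zero, by simp⟩
  · convert hg j z using 1
    simp only [hb]
    rw [polyCurve, ← Finset.sum_image (s := Finset.univ) (g := idx)
      (f := fun k => z ^ k • chartCoeff 6 j c k) (fun i _ j _ hij => hmono.injective hij)]
    refine Finset.sum_subset (fun k hk => ?_) fun k hk hk' => ?_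
    · obtain ⟨i, -, rfl⟩ := Finset.mem_image.1 hk
      exact Finset.mem_range.2 (Nat.lt_succ_iff.2 (hle i))
    · rw [h.1 k (Nat.lt_succ_iff.1 (Finset.mem_range.1 hk)), smul_zero]
      rintro i rfl
      exact hk' (Finset.mem_image_of_mem _ (Finset.mem_univ i))

include hE in
/-- There is no branching where the quartic form does not vanish. -/
theorem HasForm.hasBranchOrder_zero (hB : ∀ x y, B x y = B y x) (hg : HasForm g 6 c)
    (h : NullGram B c) {t : ℂ} (ht : quartic B c t ≠ 0) : HasBranchOrder g (chart 0 t) 0 := by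
  rw [← h.shift_zero_four hB] at ht
  have hli := (h.shift hB t).linearIndependent hB ht
  set d := shift 6 t c with hd
  let b := basisOfLinearIndependentOfCardEqFinrank hli (by rw [Fintype.card_fin, hE])
  have hb : ∀ i, b i = d i := fun i => by rw [coe_basisOfLinearIndependentOfCardEqFinrank]
  -- The first five Taylor coefficients at `t` are the basis. Expanding the last two in it only
  -- multiplies `(z - t) ^ i` by a function with value `1` at `t`, so the vanishing orders are `0,
  -- 1, 2, 3, 4`.
  refine ⟨3, fun i => i, ⟨rfl, fun i j hij => hij, 0, t, rfl, b, fun i z => (z - t) ^ (i : ℕ) *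
    (1 + b.repr (d 5) i * (z - t) ^ (5 - (i : ℕ)) + b.repr (d 6) i * (z - t) ^ (6 - (i : ℕ))),
    fun i => ⟨by fun_prop, ?_⟩, .of_forall fun z => ?_⟩, rfl⟩
  · rw [AnalyticAt.analyticOrderAt_eq_natCast (by fun_prop)]
    refine ⟨fun z => 1 + b.repr (d 5) i * (z - t) ^ (5 - (i : ℕ))
      + b.repr (d 6) i * (z - t) ^ (6 - (i : ℕ)), by fun_prop, ?_, .of_forall fun z => rfl⟩
    have h5 : 5 - (i : ℕ) ≠ 0 := by omega
    have h6 : 6 - (i : ℕ) ≠ 0 := by omega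
    simp [h5, h6]
  · convert hg.zero z using 1
    have h1 := polyCurve_shift 6 t c (z - t)
    rw [sub_add_cancel, ← hd] at h1
    rw [← h1, polyCurve, Finset.sum_range_succ, Finset.sum_range_succ, Finset.sum_range]
    have e : ∀ v : E, v = ∑ i, b.repr v i • b i := fun v => (b.sum_repr v).symm
    rw [e (d 5), e (d 6), Finset.smul_sum, Finset.smul_sum, ← Finset.sum_add_distrib,
      ← Finset.sum_add_distrib]
    refine Finset.sum_congr rfl fun i _ => ?_
    rw [← hb i, smul_smul, smul_smul, ← add_smul, ← add_smul]
    congr 1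
    have e5 : (z - t) ^ 5 = (z - t) ^ (i : ℕ) * (z - t) ^ (5 - (i : ℕ)) := by
      rw [← pow_add]; congr 1; omega
    have e6 : (z - t) ^ 6 = (z - t) ^ (i : ℕ) * (z - t) ^ (6 - (i : ℕ)) := by
      rw [← pow_add]; congr 1; omega
    rw [e5, e6, b.sum_repr, b.sum_repr]
    ring

theorem IsNormalA.nullGram (h : IsNormalA B c) : NullGram B c := by
  obtain ⟨h0, x, -, hx⟩ := h
  have h2 : c 2 = 0 := h0 2 (by norm_num) (by decide)
  have h4 : c 4 = 0 := h0 4 (by norm_num) (by decide)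
  have e := fun i j => hx i j
  simp [Fin.forall_fin_succ, Fin.rev] at e
  constructor <;> simp [h2, h4, e] <;> first | done | grind

theorem IsNormalB.nullGram (h : IsNormalB B c) : NullGram B c := by
  obtain ⟨h0, x, -, hx⟩ := h
  have h1 : c 1 = 0 := h0 1 (by norm_num) (by decide)
  have h5 : c 5 = 0 := h0 5 (by norm_num) (by decide)
  have e := fun i j => hx i j
  simp [Fin.forall_fin_succ, Fin.rev] at e
  constructor <;> simp [h1, h5, e] <;> first | done | grind

end NormalCurves

/-! ### The two models: branching, inequivalence and completeness -/

section Models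

variable {E : Type*} [AddCommGroup E] [Module ℂ E] {B : LinearMap.BilinForm ℂ E} {c : ℕ → E}
  {g : P1 → ℙ ℂ E} (hE : Module.finrank ℂ E = 5)

theorem gammaA_ne_zero (i : Fin 5) : (![2 / 5, -9 / 10, 1, -9 / 10, 2 / 5] : Fin 5 → ℂ) i ≠ 0 := by
  fin_cases i <;> norm_num

theorem gammaB_ne_zero (i : Fin 5) :
    (![1 / 16, -9 / 16, 1, -9 / 16, 1 / 16] : Fin 5 → ℂ) i ≠ 0 := by
  fin_cases i <;> norm_num

theorem IsNormalA.chartCoeff (h : IsNormalA B c) (j : Fin 2) :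
    IsNormalA B (chartCoeff 6 j c) := by
  unfold NullCurve.chartCoeff
  split_ifs
  · exact h
  · exact IsNormal.reverse h (by decide) fun i => by fin_cases i <;> rfl

theorem IsNormalB.chartCoeff (h : IsNormalB B c) (j : Fin 2) :
    IsNormalB B (chartCoeff 6 j c) := by
  unfold NullCurve.chartCoeff
  split_ifs
  · exact h
  · exact IsNormal.reverse h (by decide) fun i => by fin_cases i <;> rfl

/-- Here the quartic is `3 / 2 * x * t ^ 2`, where `x = B (c 3) (c 3)`. -/
theorem IsNormalA.quartic_ne_zero (h : IsNormalA B c) {t : ℂ} (ht : t ≠ 0) :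
    quartic B c t ≠ 0 := by
  obtain ⟨h0, x, hx0, hx⟩ := h
  have h2 : c 2 = 0 := h0 2 (by norm_num) (by decide)
  have h4 : c 4 = 0 := h0 4 (by norm_num) (by decide)
  have e := fun i j => hx i j
  simp [Fin.forall_fin_succ, Fin.rev] at e
  simp [quartic, h2, h4, e, hx0, ht]

theorem IsNormalB.quartic_ne_zero (h : IsNormalB B c) {t : ℂ} (ht : t ≠ 0) :
    quartic B c t ≠ 0 := by
  obtain ⟨h0, x, hx0, hx⟩ := h
  have h1 : c 1 = 0 := h0 1 (by norm_num) (by decide)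
  have h5 : c 5 = 0 := h0 5 (by norm_num) (by decide)
  have e := fun i j => hx i j
  simp [Fin.forall_fin_succ, Fin.rev] at e
  have : quartic B c t = 3 / 8 * x * t ^ 2 := by
    simp [quartic, h1, h5, e, ht]
    ring
  rw [this]
  simp [hx0, ht]

include hE

theorem HasForm.isUnbranched (hB : ∀ x y, B x y = B y x) (hg : HasForm g 6 c)
    (h : IsNormalA B c) : IsUnbranched g := by
  have hj : ∀ j, HasBranchOrder g (chart j 0) 0 := fun j =>
    hg.hasBranchOrder_center hE (h.chartCoeff j) gammaA_ne_zero (by decide) rfl (by decide)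
  intro p
  rcases exists_chart p with ⟨z, rfl⟩ | rfl
  · by_cases hz : z = 0
    · rw [hz]
      exact hj 0
    · exact hg.hasBranchOrder_zero hE hB h.nullGram (h.quartic_ne_zero hz)
  · exact hj 1

theorem HasForm.hasTwoSimpleBranchPoints (hB : ∀ x y, B x y = B y x) (hg : HasForm g 6 c)
    (h : IsNormalB B c) : HasTwoSimpleBranchPoints g := by
  have hj : ∀ j, HasBranchOrder g (chart j 0) 1 := fun j =>
    hg.hasBranchOrder_center hE (h.chartCoeff j) gammaB_ne_zero (by decide) rfl (by decide)
  refine ⟨chart 0 0, chart 1 0, chart_zero_ne_infty 0, hj 0, hj 1, fun p h0 h1 => ?_⟩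
  rcases exists_chart p with ⟨z, rfl⟩ | rfl
  · have hz : z ≠ 0 := by
      rintro rfl
      exact h0 rfl
    exact hg.hasBranchOrder_zero hE hB h.nullGram (h.quartic_ne_zero hz)
  · exact absurd rfl h1

/-- Through every point of the unbranched curve there is a hyperplane that meets the curve in six
points. -/
theorem HasForm.exists_section_encard_eq_six (hg : HasForm g 6 c) (h : IsNormalA B c) (p : P1) :
    ∃ l : Module.Dual ℂ E, (g p).submodule ≤ LinearMap.ker l ∧
      {q | (g q).submodule ≤ LinearMap.ker l}.encard = 6 := by
  have h2 : c 2 = 0 := h.1 2 (by norm_num) (by decide)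
  have h4 : c 4 = 0 := h.1 4 (by norm_num) (by decide)
  have hfin : ∀ j : Fin 2, j = 0 ∨ j = 1 := by decide
  by_cases hp : ∃ t, t ≠ 0 ∧ p = chart 0 t
  · obtain ⟨t, ht, rfl⟩ := hp
    obtain ⟨l, hl0, hl6, hl⟩ :=
      IsNormal.exists_dual_ends hE h gammaA_ne_zero rfl rfl (-t ^ 6) 1
    refine ⟨l, ?_, hg.encard_section_of_nowhereTangent (hg.nowhereTangent fun j z hz => ?_)⟩
    · rw [(hg.zero t).le_ker_iff, map_polyCurve]
      simp [polyCurve, Finset.sum_range_succ, hl0, hl6, hl]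
    · have hz0 : z ≠ 0 := by
        rintro rfl
        rw [polyCurve_zero] at hz
        rcases hfin j with rfl | rfl
        · simp [NullCurve.chartCoeff, hl0, ht] at hz
        · simp [NullCurve.chartCoeff, NullCurve.reverse, hl6] at hz
      rcases hfin j with rfl | rfl
      · simp [NullCurve.chartCoeff, polyDeriv, Finset.sum_range_succ, hl6, hl, hz0]
      · simp [NullCurve.chartCoeff, polyDeriv, Finset.sum_range_succ, hl0, hl, NullCurve.reverse,
          hz0, ht]
  -- For the points `0` and `∞` the hyperplane is given by `z - z ^ 5`, a form of degree `6` with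
  -- simple zeros at `0`, `∞` and the fourth roots of unity.
  · obtain ⟨l, hl⟩ := IsNormal.exists_dual hE h gammaA_ne_zero ![0, 1, 0, -1, 0]
    simp [Fin.forall_fin_succ] at hl
    obtain ⟨hl0, hl1, hl3, hl5, hl6⟩ := hl
    refine ⟨l, ?_, hg.encard_section_of_nowhereTangent (hg.nowhereTangent fun j z hz => ?_)⟩
    · rcases exists_chart p with ⟨z, rfl⟩ | rfl
      · have : z = 0 := by
          by_contra hz
          exact hp ⟨z, hz, rfl⟩
        rw [(hg.zero z).le_ker_iff, this, polyCurve_zero, hl0]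
      · rw [hg.infty.le_ker_iff, hl6]
    · have hz' : z * (1 - z ^ 4) = 0 := by
        rcases hfin j with rfl | rfl
        · simp [NullCurve.chartCoeff, polyCurve, Finset.sum_range_succ, hl0, hl1, hl3, hl5, hl6, h2,
            h4] at hz
          linear_combination hz
        · simp [NullCurve.chartCoeff, polyCurve, Finset.sum_range_succ, hl0, hl1, hl3, hl5, hl6, h2,
            h4, NullCurve.reverse] at hz
          linear_combination -hz
      have hne : 1 - 5 * z ^ 4 ≠ 0 := by
        intro h0
        rcases mul_eq_zero.1 hz' with h1 | h1
        · simp [h1] at h0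
        · have : (4 : ℂ) = 0 := by linear_combination 5 * h1 - h0
          norm_num at this
      rcases hfin j with rfl | rfl
      · simp [NullCurve.chartCoeff, polyDeriv, Finset.sum_range_succ, hl1, hl3, hl5, hl6, h2, h4]
        exact fun h0 => hne (by linear_combination h0)
      · simp [NullCurve.chartCoeff, polyDeriv, Finset.sum_range_succ, hl0, hl1, hl3, hl5, h2, h4,
          NullCurve.reverse]
        exact fun h0 => hne (by linear_combination -h0)

omit hE in
/-- A hyperplane through a branch point does not meet the branched curve in six points. -/
theorem HasForm.section_encard_ne_six (hg : HasForm g 6 c) (h : IsNormalB B c)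
    (l : Module.Dual ℂ E) (hl : (g (chart 0 0)).submodule ≤ LinearMap.ker l) :
    {q | (g q).submodule ≤ LinearMap.ker l}.encard ≠ 6 := by
  have h1 : c 1 = 0 := h.1 1 (by norm_num) (by decide)
  have h5 : c 5 = 0 := h.1 5 (by norm_num) (by decide)
  rw [(hg.zero 0).le_ker_iff, polyCurve_zero] at hl
  set a : ℕ → ℂ := fun k => l (c (k + 2)) with ha
  -- Since `c 1 = 0`, a section vanishing at `0` is divisible by `z ^ 2`; the quotient has degree at
  -- most `4`, which leaves at most five distinct points.
  have hroots : {z | polyCurve 6 (fun k => l (c k)) z = 0} = insert 0 {z | (toPoly 4 a).eval z = 0} := by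
    ext z
    simp only [Set.mem_ofPred_eq, Set.mem_insert_iff]
    rw [eval_toPoly]
    have : polyCurve 6 (fun k => l (c k)) z = z ^ 2 * polyCurve 4 a z := by
      simp [polyCurve, Finset.sum_range_succ, ha, hl, h1]
      ring
    rw [this, mul_eq_zero, pow_eq_zero_iff (by norm_num)]
  intro h6
  rw [hg.encard_section, hroots] at h6
  -- A zero quotient means that the hyperplane contains the whole curve, so the section is infinite.
  by_cases hr : toPoly 4 a = 0
  · have : insert 0 {z | (toPoly 4 a).eval z = 0} = Set.univ := by simp [hr]
    rw [this, Set.encard_univ, ENat.card_eq_top_of_infinite, top_add] at h6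
    exact absurd h6 (by decide)
  have hle : {z | (toPoly 4 a).eval z = 0}.encard + {p : P1 | p = chart 1 0 ∧ l (c 6) = 0}.encard
      ≤ 4 := by
    by_cases hc6 : l (c 6) = 0
    -- The point `∞` is also a branch point: as `c 5 = 0`, passing through it lowers the degree by
    -- two.
    · have hdeg : (toPoly 4 a).natDegree ≤ 2 := by
        have e : toPoly 4 a = toPoly 2 a := by
          simp [toPoly, Finset.sum_range_succ, ha, h5, hc6]
        rw [e]
        exact natDegree_toPoly_le 2 a
      calc _ ≤ (2 : ℕ∞) + 1 := add_le_add
            ((encard_roots_le hr).trans (by exact_mod_cast hdeg))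
            ((Set.encard_le_encard (t := {chart 1 0}) fun q hq => hq.1).trans
              (Set.encard_singleton _).le)
        _ ≤ 4 := by norm_num
    · have : {p : P1 | p = chart 1 0 ∧ l (c 6) = 0} = ∅ := by
        ext q
        exact ⟨fun hq => hc6 hq.2, fun hq => hq.elim⟩
      rw [this, Set.encard_empty, add_zero]
      exact (encard_roots_le hr).trans (by exact_mod_cast natDegree_toPoly_le 4 a)
  have h7 : (6 : ℕ∞) ≤ 4 + 1 := by
    rw [← h6]
    calc _ ≤ ({z | (toPoly 4 a).eval z = 0}.encard + 1) + _ :=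
          add_le_add_left (Set.encard_insert_le _ _) _
      _ = ({z | (toPoly 4 a).eval z = 0}.encard + {p : P1 | p = chart 1 0 ∧ l (c 6) = 0}.encard)
          + 1 := by rw [add_right_comm]
      _ ≤ 4 + 1 := add_le_add_left hle _
  exact absurd h7 (by decide)

/-- The number of points in a hyperplane section is a projective invariant. The comparison is made
at the point of the unbranched curve that corresponds to the branch point at coordinate `0`. -/
theorem not_projEquiv {c' : ℕ → E} {g' : P1 → ℙ ℂ E} (hg : HasForm g 6 c) (h : IsNormalA B c)
    (hg' : HasForm g' 6 c') (h' : IsNormalB B c') : ¬ ProjEquiv B g g' := by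
  rintro ⟨A, T, -, hT⟩
  let φ : P1 → P1 := Projectivization.map A.toLinearMap A.injective
  let ψ : P1 → P1 := Projectivization.map A.symm.toLinearMap A.symm.injective
  have hφψ : ∀ p, φ (ψ p) = p := fun p => by
    induction p using Projectivization.ind with
    | h v hv => simp [φ, ψ, Projectivization.map_mk]
  have hφ : Function.Injective φ := Projectivization.map_injective _ A.injective
  obtain ⟨l, hl, hl6⟩ := hg.exists_section_encard_eq_six hE h (ψ (chart 0 0))
  have key : ∀ p, (g' (φ p)).submodule ≤ LinearMap.ker (l ∘ₗ T.symm.toLinearMap) ↔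
      (g p).submodule ≤ LinearMap.ker l := fun p => by
    have h1 := isClassOf_rep (g p)
    have h2 := h1.map T.toLinearMap T.injective
    rw [← hT p] at h2
    rw [h2.le_ker_iff, h1.le_ker_iff]
    simp
  refine hg'.section_encard_ne_six h' (l ∘ₗ T.symm.toLinearMap) ?_ ?_
  · rw [← hφψ (chart 0 0), key]
    exact hl
  · rw [← hl6]
    refine Eq.trans (congrArg Set.encard ?_) (hφ.encard_image _)
    ext q
    constructor
    · intro hq
      refine ⟨ψ q, ?_, hφψ q⟩
      rw [← hφψ q] at hq
      exact (key _).1 hq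
    · rintro ⟨p, hp, rfl⟩
      exact (key p).2 hp

theorem projEquiv_or_projEquiv (hB : ∀ x y, B x y = B y x) (hnd : ∀ w, (∀ u, B w u = 0) → w = 0)
    {c₁ c₂ : ℕ → E} {g₁ g₂ : P1 → ℙ ℂ E} (hg₁ : HasForm g₁ 6 c₁) (h₁ : IsNormalA B c₁)
    (hg₂ : HasForm g₂ 6 c₂) (h₂ : IsNormalB B c₂) (hg : IsNullCurve B g) (hnl : IsNonlinear g)
    (hdeg : HasDegree g 6) : ProjEquiv B g g₁ ∨ ProjEquiv B g g₂ := by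
  have : Module.Finite ℂ E := Module.finite_of_finrank_pos (by omega)
  obtain ⟨c, hc⟩ := exists_hasForm_of_hasDegree hg.holomorphic hdeg
  have hnull := hc.nullGram hB hg
  obtain ⟨t, ht⟩ := hnull.exists_quartic_ne_zero hE hB hnd (hc.not_exists_of_isNonlinear hnl)
  obtain ⟨A, d, hd, hd1, hd2, hd3, hd4⟩ :=
    exists_reparam hE hB hc hnull (hnull.isFull hE hB hnd ht)
  have hd0 : d 0 ≠ 0 := by
    have := (hd.zero 0).ne_zero
    rwa [polyCurve_zero] at this
  rcases hd1.isNormal hE hB hd2 hd0 hd3 hd4 with hA | hA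
  · exact Or.inl (projEquiv_of_isNormal hE gammaA_ne_zero hA h₁ A hd hg₁)
  · exact Or.inr (projEquiv_of_isNormal hE gammaB_ne_zero hA h₂ A hd hg₂)

end Models

/-! ### Bivectors, adapted bases and the inner product on `W` -/

section Exterior

variable {V : Type*} [AddCommGroup V] [Module ℂ V]

theorem wedge_add_left (x y z : V) : wedge (x + y) z = wedge x z + wedge y z := by
  have h := (exteriorPower.ιMulti ℂ 2).map_update_add ![x, z] 0 x y
  simpa [-AlternatingMap.map_update_add, update_pair_0, wedge] using h

theorem wedge_add_right (x y z : V) : wedge z (x + y) = wedge z x + wedge z y := by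
  have h := (exteriorPower.ιMulti ℂ 2).map_update_add ![z, x] 1 x y
  simpa [-AlternatingMap.map_update_add, update_pair_1, wedge] using h

theorem wedge_smul_left (a : ℂ) (x z : V) : wedge (a • x) z = a • wedge x z := by
  have h := (exteriorPower.ιMulti ℂ 2).map_update_smul ![x, z] 0 a x
  simpa [-AlternatingMap.map_update_smul, update_pair_0, wedge] using h

theorem wedge_smul_right (a : ℂ) (x z : V) : wedge z (a • x) = a • wedge z x := by
  have h := (exteriorPower.ιMulti ℂ 2).map_update_smul ![z, x] 1 a x
  simpa [-AlternatingMap.map_update_smul, update_pair_1, wedge] using h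

theorem wedge_self (x : V) : wedge x x = 0 :=
  (exteriorPower.ιMulti ℂ 2).map_eq_zero_of_eq ![x, x] (i := 0) (j := 1) rfl (by decide)

theorem wedge_swap (x y : V) : wedge x y = -wedge y x := by
  have h := wedge_self (x + y)
  rw [wedge_add_left, wedge_add_right, wedge_add_right, wedge_self, wedge_self, zero_add,
    add_zero] at h
  exact eq_neg_of_add_eq_zero_left h

variable (β : V [⋀^Fin 2]→ₗ[ℂ] ℂ)

/-- The symmetric bilinear form `Ω(w₁ ∧ w₂)` on all bivectors. -/
def innerExt : ⋀[ℂ]^2 V →ₗ[ℂ] ⋀[ℂ]^2 V →ₗ[ℂ] ℂ :=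
  LinearMap.mk₂ ℂ
    (fun w₁ w₂ => volumeFunctional β ((w₁ : ExteriorAlgebra ℂ V) * (w₂ : ExteriorAlgebra ℂ V)))
    (by intros; simp [add_mul]) (by intros; simp)
    (by intros; simp [mul_add]) (by intros; simp)

theorem innerW_apply (w₁ w₂ : W β) : innerW β w₁ w₂ = innerExt β w₁ w₂ := rfl

theorem innerExt_wedge (a b c d : V) :
    innerExt β (wedge a b) (wedge c d) = β ![a, b] * β ![c, d] - β ![a, c] * β ![b, d]
      + β ![a, d] * β ![b, c] := by
  have h : ((wedge a b : ⋀[ℂ]^2 V) : ExteriorAlgebra ℂ V) * ((wedge c d : ⋀[ℂ]^2 V) :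
      ExteriorAlgebra ℂ V) = ExteriorAlgebra.ιMulti ℂ 4 ![a, b, c, d] := by
    simp [wedge, ExteriorAlgebra.ιMulti_apply, mul_assoc]
  change volumeFunctional β _ = _
  rw [h, volumeFunctional, ExteriorAlgebra.liftAlternating_apply_ιMulti, Pi.single_eq_same]
  rfl

theorem innerExt_comm (w₁ w₂ : ⋀[ℂ]^2 V) : innerExt β w₁ w₂ = innerExt β w₂ w₁ := by
  have h : innerExt β = (innerExt β).flip := by
    refine exteriorPower.linearMap_ext ?_
    ext v w
    have hv : v = ![v 0, v 1] := by ext i; fin_cases i <;> rfl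
    have hw : w = ![w 0, w 1] := by ext i; fin_cases i <;> rfl
    change innerExt β (exteriorPower.ιMulti ℂ 2 v) (exteriorPower.ιMulti ℂ 2 w) =
      innerExt β (exteriorPower.ιMulti ℂ 2 w) (exteriorPower.ιMulti ℂ 2 v)
    rw [hv, hw]
    change innerExt β (wedge _ _) (wedge _ _) = innerExt β (wedge _ _) (wedge _ _)
    rw [innerExt_wedge, innerExt_wedge, form_swap β (w 0) (v 0), form_swap β (w 1) (v 1),
      form_swap β (w 0) (v 1), form_swap β (w 1) (v 0)]
    ring
  conv_lhs => rw [h]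
  rfl

theorem innerW_comm (w₁ w₂ : W β) : innerW β w₁ w₂ = innerW β w₂ w₁ := innerExt_comm β _ _

theorem mem_W_iff (w : ⋀[ℂ]^2 V) : w ∈ W β ↔ exteriorPower.alternatingMapLinearEquiv β w = 0 :=
  LinearMap.mem_ker

theorem alternatingMapLinearEquiv_wedge (x y : V) :
    exteriorPower.alternatingMapLinearEquiv β (wedge x y) = β ![x, y] :=
  exteriorPower.alternatingMapLinearEquiv_apply_ιMulti _ _

/-- A basis in which the matrix of `β` is antidiagonal, with entries `1` and `s`. -/
structure IsAdapted (s : ℂ) (v : Fin 4 → V) : Prop where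
  h01 : β ![v 0, v 1] = 0
  h02 : β ![v 0, v 2] = 0
  h03 : β ![v 0, v 3] = 1
  h12 : β ![v 1, v 2] = s
  h13 : β ![v 1, v 3] = 0
  h23 : β ![v 2, v 3] = 0

/-- The bilinear form of an alternating `2`-form. -/
def toBilin : LinearMap.BilinForm ℂ V :=
  LinearMap.mk₂ ℂ (fun x y => β ![x, y]) (fun x y z => form_add_left β x y z)
    (fun a x z => form_smul_left β a x z) (fun z x y => form_add_right β x y z)
    (fun a z x => form_smul_right β a x z)

variable {β}

/-- The symplectic Gram–Schmidt process: a hyperbolic pair `e0, e3`, then a second pair orthogonal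
to it. The value `s` is free because the last vector can be rescaled. -/
theorem exists_adapted_basis (hV : Module.finrank ℂ V = 4) (hβ : IsNondegenerate β) {s : ℂ}
    (hs : s ≠ 0) : ∃ v : Module.Basis (Fin 4) ℂ V, IsAdapted β s v := by
  have : Module.Finite ℂ V := Module.finite_of_finrank_pos (by omega)
  have : Nontrivial V := Module.nontrivial_of_finrank_pos (R := ℂ) (by omega)
  have hex : ∀ x : V, x ≠ 0 → ∀ a : ℂ, ∃ y, β ![x, y] = a := by
    intro x hx a
    obtain ⟨y, hy⟩ : ∃ y, β ![x, y] ≠ 0 := by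
      by_contra! h
      exact hx (hβ x h)
    exact ⟨(a / β ![x, y]) • y, by rw [form_smul_right, div_mul_cancel₀ _ hy]⟩
  obtain ⟨e0, he0⟩ := exists_ne (0 : V)
  obtain ⟨e3, h03⟩ := hex e0 he0 1
  let φ : V →ₗ[ℂ] (Fin 2 → ℂ) := LinearMap.pi ![toBilin β e0, toBilin β e3]
  have hker : LinearMap.ker φ ≠ ⊥ := LinearMap.ker_ne_bot_of_finrank_lt (by
    rw [hV, Module.finrank_fin_fun]; norm_num)
  obtain ⟨e1, he1, he1'⟩ := (Submodule.ne_bot_iff _).1 hker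
  have h01 : β ![e0, e1] = 0 := congrFun (LinearMap.mem_ker.1 he1) 0
  have h31 : β ![e3, e1] = 0 := congrFun (LinearMap.mem_ker.1 he1) 1
  obtain ⟨u, hu⟩ := hex e1 he1' s
  -- The coefficients `a` and `b` make `u + a • e0 + b • e3` orthogonal to `e3` and `e0`; the
  -- product with `e1` remains `s`.
  obtain ⟨a, ha⟩ : ∃ a, a = -β ![u, e3] := ⟨_, rfl⟩
  obtain ⟨b, hb⟩ : ∃ b, b = -β ![e0, u] := ⟨_, rfl⟩
  have hadapt : IsAdapted β s ![e0, e1, u + a • e0 + b • e3, e3] := by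
    have h10 := form_swap β e1 e0
    have h13 := form_swap β e1 e3
    rw [h01, neg_zero] at h10
    rw [h31, neg_zero] at h13
    constructor <;> simp [form_add_left, form_add_right, form_smul_left, form_smul_right,
      form_self, h01, h03, h10, h13, hu, -Fin.isValue]
    · rw [hb]; ring
    · rw [ha]; ring
  generalize ![e0, e1, u + a • e0 + b • e3, e3] = v at hadapt
  obtain ⟨h01, h02, h03, h12, h13, h23⟩ := hadapt
  have h10 : β ![v 1, v 0] = 0 := by rw [form_swap, h01, neg_zero]
  have h20 : β ![v 2, v 0] = 0 := by rw [form_swap, h02, neg_zero]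
  have hli : LinearIndependent ℂ v := by
    refine linearIndependent_of_triangular (B := toBilin β) (fun i => v i.rev) v
      (fun i j hij => ?_) fun i => ?_
    · change β ![v i.rev, v j] = 0
      fin_cases i <;> fin_cases j <;> simp at hij <;> simp [Fin.rev, form_self, h01, h02, h10, h20]
    · change β ![v i.rev, v i] ≠ 0
      fin_cases i <;> simp [Fin.rev, h03, h12, hs]
      · rw [form_swap, h03]; norm_num
      · rw [form_swap, h12]; simpa
  refine ⟨basisOfLinearIndependentOfCardEqFinrank hli (by rw [Fintype.card_fin, hV]), ?_⟩
  rw [coe_basisOfLinearIndependentOfCardEqFinrank]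
  exact ⟨h01, h02, h03, h12, h13, h23⟩

theorem finrank_W (hV : Module.finrank ℂ V = 4) (hβ : IsNondegenerate β) :
    Module.finrank ℂ (W β) = 5 := by
  have : Module.Finite ℂ V := Module.finite_of_finrank_pos (by omega)
  obtain ⟨v, hv⟩ := exists_adapted_basis hV hβ one_ne_zero
  have hne : exteriorPower.alternatingMapLinearEquiv β ≠ 0 := by
    intro h
    have := alternatingMapLinearEquiv_wedge β (v 0) (v 3)
    rw [h, hv.h03] at this
    simp at this
  have h1 := Module.Dual.finrank_ker_add_one_of_ne_zero hne
  rw [exteriorPower.finrank_eq, hV] at h1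
  exact Nat.succ_injective h1

/-- A form admitting a curve in normal form has an invertible antidiagonal Gram matrix. For `innerW`
this makes the model curve itself a proof of nondegeneracy. -/
theorem IsNormal.nondegenerate {E : Type*} [AddCommGroup E] [Module ℂ E]
    {B : LinearMap.BilinForm ℂ E} {c : ℕ → E} {idx : Fin 5 → ℕ} {γ : Fin 5 → ℂ}
    (hE : Module.finrank ℂ E = 5) (h : IsNormal B idx γ c) (hγ : ∀ i, γ i ≠ 0) (w : E)
    (hw : ∀ u, B w u = 0) : w = 0 := by
  obtain ⟨b, hb⟩ := h.exists_basis hE hγ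
  obtain ⟨-, x, hx, hx'⟩ := h
  refine b.ext_elem fun i => ?_
  have h1 := hw (b i.rev)
  rw [← b.sum_repr w, map_sum, LinearMap.sum_apply, Finset.sum_eq_single i] at h1
  · rw [map_smul, LinearMap.smul_apply, hb, hb, hx', if_pos rfl, smul_eq_mul] at h1
    rw [map_zero, Finsupp.zero_apply]
    exact (mul_eq_zero.1 h1).resolve_right (mul_ne_zero hx (hγ i))
  · intro j _ hj
    rw [map_smul, LinearMap.smul_apply, hb, hb, hx', if_neg, smul_zero]
    exact fun h => hj (Fin.rev_injective h).symm
  · exact fun h => absurd (Finset.mem_univ i) h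

end Exterior

/-! ### The contact curves and their associated null curves -/

section ContactCurves

variable {V : Type*} [AddCommGroup V] [Module ℂ V] {β : V [⋀^Fin 2]→ₗ[ℂ] ℂ}

theorem coe_polyCurve_chartCoeff (c : ℕ → W β) (n : ℕ) (j : Fin 2) (z : ℂ) :
    ((polyCurve n (chartCoeff n j c) z : W β) : ⋀[ℂ]^2 V) =
      polyCurve n (chartCoeff n j fun k => (c k : ⋀[ℂ]^2 V)) z := by
  have h := map_polyCurve (W β).subtype n (chartCoeff n j c) z
  refine Eq.trans h ?_
  unfold chartCoeff
  split_ifs <;> rfl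

/-- The bivector `F ∧ F'` is a multiple of an element of `W`, on which `β` vanishes; changing the
lift only multiplies `F ∧ F'` by a scalar. -/
theorem isContactCurve_of_wedge_eq {f : P1 → ℙ ℂ V} {m : ℕ} {b : ℕ → V} {c : ℕ → W β}
    (hf : HasForm f m b)
    (hw : ∀ j z, ∃ s : ℂ, wedge (polyCurve m (chartCoeff m j b) z)
      (polyDeriv m (chartCoeff m j b) z) =
        s • polyCurve 6 (chartCoeff 6 j fun k => (c k : ⋀[ℂ]^2 V)) z) : IsContactCurve β f := by
  refine ⟨hf.isHolomorphic, fun j z F F' hF hF' => ?_⟩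
  obtain ⟨a, a', -, h1, h2⟩ := hF.exists_factor (hf.isLocalLift j z) hF'
    (hasVecDerivAt_polyCurve _ _ z)
  obtain ⟨s, hs⟩ := hw j z
  have h3 := alternatingMapLinearEquiv_wedge β (polyCurve m (chartCoeff m j b) z)
    (polyDeriv m (chartCoeff m j b) z)
  rw [hs, ← coe_polyCurve_chartCoeff, map_smul, (mem_W_iff β _).1 (SetLike.coe_mem _),
    smul_zero] at h3
  rw [h1, h2, form_add_right, form_smul_left, form_smul_left, form_smul_right, form_smul_right,
    form_self, ← h3]
  ring

theorem isSecondAssociatedCurve_of_wedge_eq {f : P1 → ℙ ℂ V} {g : P1 → ℙ ℂ (W β)} {m : ℕ}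
    {b : ℕ → V} {c : ℕ → W β} (hf : HasForm f m b) (hg : HasForm g 6 c)
    (hw : ∀ j z, ∃ s : ℂ, wedge (polyCurve m (chartCoeff m j b) z)
      (polyDeriv m (chartCoeff m j b) z) =
        s • polyCurve 6 (chartCoeff 6 j fun k => (c k : ⋀[ℂ]^2 V)) z) :
    IsSecondAssociatedCurve β f g := by
  refine ⟨hg.isHolomorphic, fun j z F F' hF hF' hne => ?_⟩
  obtain ⟨a, a', -, h1, h2⟩ := hF.exists_factor (hf.isLocalLift j z) hF'
    (hasVecDerivAt_polyCurve _ _ z)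
  obtain ⟨s, hs⟩ := hw j z
  have h3 : wedge (F z) F' =
      (a * a * s) • (W β).subtype (polyCurve 6 (chartCoeff 6 j c) z) := by
    rw [h1, h2, wedge_add_right, wedge_smul_left, wedge_smul_left, wedge_smul_right,
      wedge_smul_right, wedge_self, hs, ← coe_polyCurve_chartCoeff, Submodule.subtype_apply]
    module
  have h4 : a * a * s ≠ 0 := by
    intro h
    rw [h3, h, zero_smul] at hne
    exact hne rfl
  rw [h3]
  exact ((hg j z).map (W β).subtype (W β).injective_subtype).smul h4

/-- The coefficients of `[1, z², z³, z⁵]`. -/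
def contactA (v : Fin 4 → V) : ℕ → V
  | 0 => v 0
  | 2 => v 1
  | 3 => v 2
  | 5 => v 3
  | _ => 0

/-- The coefficients of `F ∧ F' / z` for `F = [1, z², z³, z⁵]`. -/
def bivectorA (v : Fin 4 → V) : ℕ → ⋀[ℂ]^2 V
  | 0 => (2 : ℂ) • wedge (v 0) (v 1)
  | 1 => (3 : ℂ) • wedge (v 0) (v 2)
  | 3 => (5 : ℂ) • wedge (v 0) (v 3) + wedge (v 1) (v 2)
  | 5 => (3 : ℂ) • wedge (v 1) (v 3)
  | 6 => (2 : ℂ) • wedge (v 2) (v 3)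
  | _ => 0

/-- The coefficients of `[1, z, z³, z⁴]`. -/
def contactB (v : Fin 4 → V) : ℕ → V
  | 0 => v 0
  | 1 => v 1
  | 3 => v 2
  | 4 => v 3
  | _ => 0

/-- The coefficients of `F ∧ F'` for `F = [1, z, z³, z⁴]`. -/
def bivectorB (v : Fin 4 → V) : ℕ → ⋀[ℂ]^2 V
  | 0 => wedge (v 0) (v 1)
  | 2 => (3 : ℂ) • wedge (v 0) (v 2)
  | 3 => (4 : ℂ) • wedge (v 0) (v 3) + (2 : ℂ) • wedge (v 1) (v 2)
  | 4 => (3 : ℂ) • wedge (v 1) (v 3)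
  | 6 => wedge (v 2) (v 3)
  | _ => 0

/-- The bivector `F ∧ F'` vanishes at `0` and `∞`; dividing by the factor `z` in each coordinate
lowers its degree to `6`. The inversion of the coordinate changes the sign. -/
theorem wedge_contactA (v : Fin 4 → V) (j : Fin 2) (z : ℂ) :
    ∃ s : ℂ, wedge (polyCurve 5 (chartCoeff 5 j (contactA v)) z)
      (polyDeriv 5 (chartCoeff 5 j (contactA v)) z) =
        s • polyCurve 6 (chartCoeff 6 j (bivectorA v)) z := by
  rcases Fin.exists_fin_two.1 ⟨j, rfl⟩ with rfl | rfl
  · refine ⟨z, ?_⟩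
    simp [polyCurve, polyDeriv, chartCoeff, contactA, bivectorA, Finset.sum_range_succ,
      wedge_add_left, wedge_add_right, wedge_smul_left, wedge_smul_right, wedge_self,
      wedge_swap (v 2) (v 1), wedge_swap (v 3) (v 1), wedge_swap (v 3) (v 2)]
    module
  · refine ⟨-z, ?_⟩
    simp [polyCurve, polyDeriv, chartCoeff, reverse, contactA, bivectorA, Finset.sum_range_succ,
      wedge_add_left, wedge_add_right, wedge_smul_left, wedge_smul_right, wedge_self,
      wedge_swap (v 1) (v 0), wedge_swap (v 2) (v 0), wedge_swap (v 2) (v 1),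
      wedge_swap (v 3) (v 0), wedge_swap (v 3) (v 1), wedge_swap (v 3) (v 2)]
    module

theorem wedge_contactB (v : Fin 4 → V) (j : Fin 2) (z : ℂ) :
    ∃ s : ℂ, wedge (polyCurve 4 (chartCoeff 4 j (contactB v)) z)
      (polyDeriv 4 (chartCoeff 4 j (contactB v)) z) =
        s • polyCurve 6 (chartCoeff 6 j (bivectorB v)) z := by
  rcases Fin.exists_fin_two.1 ⟨j, rfl⟩ with rfl | rfl
  · refine ⟨1, ?_⟩
    simp [polyCurve, polyDeriv, chartCoeff, contactB, bivectorB, Finset.sum_range_succ,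
      wedge_add_left, wedge_add_right, wedge_smul_left, wedge_smul_right, wedge_self,
      wedge_swap (v 2) (v 1), wedge_swap (v 3) (v 1), wedge_swap (v 3) (v 2)]
    module
  · refine ⟨-1, ?_⟩
    simp [polyCurve, polyDeriv, chartCoeff, reverse, contactB, bivectorB, Finset.sum_range_succ,
      wedge_add_left, wedge_add_right, wedge_smul_left, wedge_smul_right, wedge_self,
      wedge_swap (v 1) (v 0), wedge_swap (v 2) (v 0), wedge_swap (v 2) (v 1),
      wedge_swap (v 3) (v 0), wedge_swap (v 3) (v 1), wedge_swap (v 3) (v 2)]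
    module

/-- The value `s = -5` is what makes `β` vanish on the middle coefficient `5 v₀ ∧ v₃ + v₁ ∧ v₂`; for
the second curve `4 v₀ ∧ v₃ + 2 v₁ ∧ v₂` requires `s = -2`. -/
theorem IsAdapted.bivectorA_mem {v : Fin 4 → V} (hv : IsAdapted β (-5) v) (k : ℕ) :
    bivectorA v k ∈ W β := by
  rw [mem_W_iff]
  unfold bivectorA
  split <;> simp [alternatingMapLinearEquiv_wedge, hv.h01, hv.h02, hv.h03, hv.h12, hv.h13, hv.h23]

theorem IsAdapted.bivectorB_mem {v : Fin 4 → V} (hv : IsAdapted β (-2) v) (k : ℕ) :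
    bivectorB v k ∈ W β := by
  rw [mem_W_iff]
  unfold bivectorB
  split <;> simp [alternatingMapLinearEquiv_wedge, hv.h01, hv.h02, hv.h03, hv.h12, hv.h13, hv.h23]
  norm_num

theorem IsAdapted.isNormalA {v : Fin 4 → V} (hv : IsAdapted β (-5) v) :
    IsNormalA (innerW β) (fun k => (⟨bivectorA v k, hv.bivectorA_mem k⟩ : W β)) := by
  -- The factor is the square of the middle coefficient, `2 * 5 * s` with `s = -5`.
  refine ⟨fun k hk hki => ?_, -50, by norm_num, fun i j => ?_⟩
  · have e0 := hki 0
    have e1 := hki 1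
    have e2 := hki 2
    have e3 := hki 3
    have e4 := hki 4
    interval_cases k <;> first | rfl | (simp at e0 e1 e2 e3 e4)
  · obtain ⟨h01, h02, h03, h12, h13, h23⟩ := hv
    have h10 := form_swap β (v 1) (v 0)
    have h20 := form_swap β (v 2) (v 0)
    have h30 := form_swap β (v 3) (v 0)
    have h21 := form_swap β (v 2) (v 1)
    have h31 := form_swap β (v 3) (v 1)
    have h32 := form_swap β (v 3) (v 2)
    rw [innerW_apply]
    fin_cases i <;> fin_cases j <;>
      simp [bivectorA, innerExt_wedge, form_self, h01, h02, h03, h12, h13, h23, h10, h20, h30, h21,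
        h31, h32, Fin.rev] <;> norm_num

theorem IsAdapted.isNormalB {v : Fin 4 → V} (hv : IsAdapted β (-2) v) :
    IsNormalB (innerW β) (fun k => (⟨bivectorB v k, hv.bivectorB_mem k⟩ : W β)) := by
  -- The square of the middle coefficient is `2 * 4 * 2 * s` with `s = -2`.
  refine ⟨fun k hk hki => ?_, -32, by norm_num, fun i j => ?_⟩
  · have e0 := hki 0
    have e1 := hki 1
    have e2 := hki 2
    have e3 := hki 3
    have e4 := hki 4
    interval_cases k <;> first | rfl | (simp at e0 e1 e2 e3 e4)
  · obtain ⟨h01, h02, h03, h12, h13, h23⟩ := hv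
    have h10 := form_swap β (v 1) (v 0)
    have h20 := form_swap β (v 2) (v 0)
    have h30 := form_swap β (v 3) (v 0)
    have h21 := form_swap β (v 2) (v 1)
    have h31 := form_swap β (v 3) (v 1)
    have h32 := form_swap β (v 3) (v 2)
    rw [innerW_apply]
    fin_cases i <;> fin_cases j <;>
      simp [bivectorB, innerExt_wedge, form_self, h01, h02, h03, h12, h13, h23, h10, h20, h30, h21,
        h31, h32, Fin.rev] <;> norm_num

theorem exists_hasForm_contactA (v : Module.Basis (Fin 4) ℂ V) :
    ∃ f : P1 → ℙ ℂ V, HasForm f 5 (contactA v) := by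
  refine exists_hasForm (fun z h => ?_) (v.ne_zero 3)
  have := congrArg (v.coord 0) h
  simp [polyCurve, Finset.sum_range_succ, contactA] at this

theorem exists_hasForm_contactB (v : Module.Basis (Fin 4) ℂ V) :
    ∃ f : P1 → ℙ ℂ V, HasForm f 4 (contactB v) := by
  refine exists_hasForm (fun z h => ?_) (v.ne_zero 3)
  have := congrArg (v.coord 0) h
  simp [polyCurve, Finset.sum_range_succ, contactB] at this

end ContactCurves

end NullCurve

end

/-! ### The classification theorem -/

open NullCurve in
theorem mainTheorem3 {V : Type*} [AddCommGroup V] [Module ℂ V] (hV : Module.finrank ℂ V = 4)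
    (β : V [⋀^Fin 2]→ₗ[ℂ] ℂ) (hβ : IsNondegenerate β) :
    ∃ g₁ g₂ : P1 → ℙ ℂ (W β),
      (IsNullCurve (innerW β) g₁ ∧ IsNonlinear g₁ ∧ HasDegree g₁ 6 ∧ IsUnbranched g₁ ∧
        ∃ (v : Module.Basis (Fin 4) ℂ V) (f : P1 → ℙ ℂ V),
          IsContactCurve β f ∧
          (∀ z : ℂ, IsClassOf (f (chart 0 z)) (v 0 + z ^ 2 • v 1 + z ^ 3 • v 2 + z ^ 5 • v 3)) ∧
          IsSecondAssociatedCurve β f g₁) ∧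
      (IsNullCurve (innerW β) g₂ ∧ IsNonlinear g₂ ∧ HasDegree g₂ 6 ∧ HasTwoSimpleBranchPoints g₂ ∧
        ∃ (v : Module.Basis (Fin 4) ℂ V) (f : P1 → ℙ ℂ V),
          IsContactCurve β f ∧
          (∀ z : ℂ, IsClassOf (f (chart 0 z)) (v 0 + z • v 1 + z ^ 3 • v 2 + z ^ 4 • v 3)) ∧
          IsSecondAssociatedCurve β f g₂) ∧
      ¬ ProjEquiv (innerW β) g₁ g₂ ∧
      ∀ g : P1 → ℙ ℂ (W β), IsNullCurve (innerW β) g → IsNonlinear g → HasDegree g 6 →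
        ProjEquiv (innerW β) g g₁ ∨ ProjEquiv (innerW β) g g₂ := by
  have hE := finrank_W hV hβ
  have hB := innerW_comm β
  obtain ⟨v, hv⟩ := exists_adapted_basis hV hβ (s := -5) (by norm_num)
  obtain ⟨v', hv'⟩ := exists_adapted_basis hV hβ (s := -2) (by norm_num)
  have hA := hv.isNormalA
  have hA' := hv'.isNormalB
  obtain ⟨g₁, hg₁⟩ := IsNormal.exists_hasForm hE hA gammaA_ne_zero rfl rfl
  obtain ⟨g₂, hg₂⟩ := IsNormal.exists_hasForm hE hA' gammaB_ne_zero rfl rfl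
  obtain ⟨f₁, hf₁⟩ := exists_hasForm_contactA v
  obtain ⟨f₂, hf₂⟩ := exists_hasForm_contactB v'
  refine ⟨g₁, g₂, ⟨?_, ?_, ?_, ?_, v, f₁, ?_, fun z => ?_, ?_⟩,
    ⟨?_, ?_, ?_, ?_, v', f₂, ?_, fun z => ?_, ?_⟩, ?_, fun g hg hnl hdeg => ?_⟩
  · exact hg₁.isNullCurve hB hA.nullGram (hg₁.exists_ne hE hA gammaA_ne_zero rfl rfl)
  · exact hg₁.isNonlinear hE hA gammaA_ne_zero (by decide)
  · exact hg₁.hasDegree hE hA gammaA_ne_zero rfl rfl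
  · exact hg₁.isUnbranched hE hB hA
  · exact isContactCurve_of_wedge_eq (c := fun k => ⟨bivectorA v k, hv.bivectorA_mem k⟩) hf₁
      (wedge_contactA v)
  · convert hf₁.zero z using 1
    simp [polyCurve, Finset.sum_range_succ, contactA]
  · exact isSecondAssociatedCurve_of_wedge_eq hf₁ hg₁ (wedge_contactA v)
  · exact hg₂.isNullCurve hB hA'.nullGram (hg₂.exists_ne hE hA' gammaB_ne_zero rfl rfl)
  · exact hg₂.isNonlinear hE hA' gammaB_ne_zero (by decide)
  · exact hg₂.hasDegree hE hA' gammaB_ne_zero rfl rfl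
  · exact hg₂.hasTwoSimpleBranchPoints hE hB hA'
  · exact isContactCurve_of_wedge_eq (c := fun k => ⟨bivectorB v' k, hv'.bivectorB_mem k⟩) hf₂
      (wedge_contactB v')
  · convert hf₂.zero z using 1
    simp [polyCurve, Finset.sum_range_succ, contactB]
  · exact isSecondAssociatedCurve_of_wedge_eq hf₂ hg₂ (wedge_contactB v')
  · exact not_projEquiv hE hg₁ hA hg₂ hA'
  · exact projEquiv_or_projEquiv hE hB (hA.nondegenerate hE gammaA_ne_zero) hg₁ hA hg₂ hA' hg hnl
      hdeg
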